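/- Identify $\mathbb R^2$ with $\mathbb C$. Let $(\alpha_n)_{n\ge1}\subset(0,\pi/2]$ be a sequence with $\alpha_1=\pi/2$ of one of the following two kinds: Case B: $\alpha_n=C\lambda^n$ for all $n\ge1$, with $C>0$ and $\lambda\in(0,1)$; Case C: $\alpha_n=C\lambda^{n^2}$ for all $n\ge1$, with $C>0$ and $\lambda\in(0,1/2)$. Put $A_n=e^{i\alpha_n}$ for $n\ge1$, and let $A_0=-\overline{A_2}$ be the mirror image of $A_2$ in the imaginary axis. For $n\ge1$ let $T_n$ be the midpoint of the segment $A_nA_{n+1}$, let $S_n$ be the point of the segment $A_{n-1}A_n$ with $\|A_n-S_n\|=\|A_n-T_n\|$, and let $C_n$ be the circular arc from $S_n$ to $T_n$, inside the triangle $S_nA_nT_n$, that is tangent to $A_nS_n$ at $S_n$ and to $A_nT_n$ at $T_n$. Let $J_1$ be the convex hull of $0$, $1$, the arcs $C_n$ and the segments $T_nS_{n+1}$ ($n\ge1$), let $J_2$ be the reflection of $J_1$ in the real axis, let $J_3$ be the reflection of $J_1\cup J_2$ in the imaginary axis, and let $K=J_1\cup J_2\cup J_3$. For a set $\Omega$ and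 a point $x$ let $\Pi(x;\Omega)=\{w\in\Omega : \|x-w\|=\inf_{u\in\Omega}\|x-u\|\}$; when this is always a singleton, $\Pi(\cdot;\Omega)$ is regarded as a mapping, and its directional derivative at $x_0\notin\Omega$ in the direction $v$ is $\lim_{t\to0+}\bigl(\Pi(x_0+tv;\Omega)-\Pi(x_0;\Omega)\bigr)/t$. Say that $\partial K$ is $C^1$ (respectively $C^{1,1}$) around $(1,0)$ if $(1,0)\in\partial K$ and, in a neighbourhood of $(1,0)$, $\partial K$ is a graph $x=g(y)$ with $g$ continuously differentiable near $0$ (respectively, with in addition $g'$ Lipschitz near $0$). **Theorem.** In both cases $K$ is nonempty, closed and convex, $(2,0)\notin K$, and $\Pi(y;K)$ is a singleton for every $y\in\mathbb R^2$. Moreover: In Case B, $\partial K$ is $C^{1,1}$ around $(1,0)$, and the directional derivative of $\Pi(\cdot;K)$ at $(2,0)$ in the direction $(0,1)$ does not exist. In Case C, $\partial K$ is $C^1$ but not $C^{1,1}$ around $(1,0)$, and the directional derivative of $\Pi(\cdot;K)$ at $(2,0)$ in the direction $(0,1)$ does not exist. -/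

import Mathlib

open Set Filter Topology

noncomputable section

namespace RoundedShapiro

/-- The vertices `A n = exp (i α n)` of the polygon, for `n ≥ 1`. Here `α 1 = π / 2`, so `A 1 = i`
lies on the imaginary axis; the vertex `A 0` preceding it on the symmetric polygon is the mirror
image of `A 2` in the imaginary axis. The value `α 0` is not used. -/
def A (α : ℕ → ℝ) : ℕ → ℂ
  | 0 => -(starRingEnd ℂ) (Complex.exp (α 2 * Complex.I))
  | n + 1 => Complex.exp (α (n + 1) * Complex.I)

/-- `T n` is the midpoint of the segment from `A n` to `A (n + 1)`. -/
def T (α : ℕ → ℝ) (n : ℕ) : ℂ := midpoint ℝ (A α n) (A α (n + 1))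

/-- `S n` (for `n ≥ 1`) is the point of the segment from `A n` to `A (n - 1)` whose distance
to `A n` is the distance from `A n` to `T n`. -/
def S (α : ℕ → ℝ) (n : ℕ) : ℂ :=
  AffineMap.lineMap (A α n) (A α (n - 1))
    (dist (A α n) (T α n) / dist (A α n) (A α (n - 1)))

/-- The circular arc that rounds the corner `a` of the broken line `s, a, t` (with `s` and `t`
equally far from `a`): the part, inside the triangle `s a t`, of the circle that is tangent to the
line `a s` at `s` and to the line `a t` at `t`. -/
def roundingArc (s a t : ℂ) : Set ℂ :=
  {z | z ∈ convexHull ℝ {s, a, t} ∧ ∃ c : EuclideanGeometry.Sphere ℂ,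
    c.IsTangentAt s (affineSpan ℝ {a, s}) ∧ c.IsTangentAt t (affineSpan ℝ {a, t}) ∧ z ∈ c}

/-- The arc `C n` that replaces the two segments from `S n` to `A n` and from `A n` to `T n`. -/
def arc (α : ℕ → ℝ) (n : ℕ) : Set ℂ := roundingArc (S α n) (A α n) (T α n)

/-- The convex hull of `0`, `1`, the arcs `C n` and the segments connecting them (`n ≥ 1`). -/
def J₁ (α : ℕ → ℝ) : Set ℂ :=
  convexHull ℝ ({0, 1} ∪ (⋃ n ≥ 1, arc α n) ∪ ⋃ n ≥ 1, segment ℝ (T α n) (S α (n + 1)))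

/-- The mirror image of `J₁` in the real axis. -/
def J₂ (α : ℕ → ℝ) : Set ℂ := (fun z => (starRingEnd ℂ) z) '' J₁ α

/-- The mirror image of `J₁ ∪ J₂` in the imaginary axis. -/
def J₃ (α : ℕ → ℝ) : Set ℂ := (fun z => -(starRingEnd ℂ) z) '' (J₁ α ∪ J₂ α)

/-- The rounded set. -/
def K (α : ℕ → ℝ) : Set ℂ := J₁ α ∪ J₂ α ∪ J₃ α

/-- Near the point `p` of the boundary of `Ω`, this boundary is the curve `x = g y`. -/
def IsBoundaryGraph (Ω : Set ℂ) (p : ℂ) (g : ℝ → ℝ) : Prop :=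
  p ∈ frontier Ω ∧ ∀ᶠ z in 𝓝 p, (z ∈ frontier Ω ↔ z.re = g z.im)

/-- Around `p`, the boundary of `Ω` is a curve `x = g y` with `g` continuously differentiable. -/
def BoundaryC1Around (Ω : Set ℂ) (p : ℂ) : Prop :=
  ∃ g : ℝ → ℝ, IsBoundaryGraph Ω p g ∧ ContDiffAt ℝ 1 g p.im

/-- Around `p`, the boundary of `Ω` is a curve `x = g y` with `g` continuously differentiable and
`g'` Lipschitz. -/
def BoundaryC11Around (Ω : Set ℂ) (p : ℂ) : Prop :=
  ∃ g : ℝ → ℝ, IsBoundaryGraph Ω p g ∧ ContDiffAt ℝ 1 g p.im ∧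
    ∃ s ∈ 𝓝 p.im, ∃ L, LipschitzOnWith L (deriv g) s

/-- The set of all nearest points to `x` in `Ω`. -/
def metricProjection (Ω : Set ℂ) (x : ℂ) : Set ℂ :=
  {w | w ∈ Ω ∧ Metric.infDist x Ω = ‖x - w‖}

/-- `d` is the (one-sided) directional derivative of `F` at `x` in the direction `v`. -/
def HasDirectionalDerivAt (F : ℂ → ℂ) (x v d : ℂ) : Prop :=
  Tendsto (fun t : ℝ => t⁻¹ • (F (x + t • v) - F x)) (𝓝[>] 0) (𝓝 d)

/-- `Ω` is a nonempty closed convex set, `x` lies outside of it, the metric projection onto `Ω` is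
a single-valued mapping `P`, and `P` has no directional derivative at `x` in the direction `v`. -/
def ProjectionNotDirDiffAt (Ω : Set ℂ) (x v : ℂ) : Prop :=
  Ω.Nonempty ∧ IsClosed Ω ∧ Convex ℝ Ω ∧ x ∉ Ω ∧
    ∃ P : ℂ → ℂ, (∀ y, metricProjection Ω y = {P y}) ∧ ¬ ∃ d, HasDirectionalDerivAt P x v d

end RoundedShapiro

end

set_option linter.unusedSimpArgs false

namespace RoundedShapiro

/-! The side from `A n` to `A (n + 1)` has outer normal `nrm α n` and foot point `T n`, at distance
cos `hgap α n` from the origin. Since the gaps decrease, `S (n + 1)` lies between `T n` and `A (n +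
1)`. The boundary of `K` in the right upper quadrant therefore alternates between segments with
constant normal and arcs along which the normal turns from `nrm α n` to `nrm α (n + 1)`. Each arc or
segment point used comes with a supporting line (`supp_le_of_mem_J₁`, `supp_le_of_mem_K`). Convexity
and closedness come from writing `K` as the preimage of the compact convex set `J₁` under reflection
into the first quadrant (`K_eq`).

Regularity: as a function of the ordinate, the sine of the normal angle is constant on segments and
affine with slope 1/radius on arcs. It extends continuously by 0 to the point 1, so the boundary is
a C¹ graph with slope minus the tangent of the normal angle. The derivative is Lipschitz if the
curvatures 1/`arcR` are bounded (`exists_normalAngle`, `exists_boundaryGraph`). Curvature is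
controlled by the ratio of consecutive gaps (`one_div_arcR_le`), and conversely a Lipschitz slope
bounds that ratio (`BoundaryC11Around.exists_hgap_le`). The ratio is constant in Case B and
unbounded in Case C.

Projection: the outward normals along a side meet the line re = 2 in explicit points, so the
difference quotients of the projection at 2 are known there. At the foot points `T n` they tend to
1/2, as for the unit disc. At the other ends `S (n + 1)` they would have to stay below 1/2 by a
fixed amount, because the flat segment has length at least a fixed multiple of the sine of its
normal angle (`sin_hgap_sub_ge`). Hence there is no limit (`not_hasDirectionalDerivAt`), in either
case. -/

/-! ### Rounding a single corner. -/

/-- The unit vector with argument `φ`. -/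
noncomputable def dir (φ : ℝ) : ℂ := ⟨Real.cos φ, Real.sin φ⟩

@[simp] lemma dir_re (φ : ℝ) : (dir φ).re = Real.cos φ := rfl
@[simp] lemma dir_im (φ : ℝ) : (dir φ).im = Real.sin φ := rfl

lemma exp_eq_dir (φ : ℝ) : Complex.exp (φ * Complex.I) = dir φ := by
  apply Complex.ext <;> simp [Complex.exp_ofReal_mul_I_re, Complex.exp_ofReal_mul_I_im]

lemma norm_dir (φ : ℝ) : ‖dir φ‖ = 1 := by
  rw [← exp_eq_dir, Complex.norm_exp_ofReal_mul_I]

lemma inner_eq_re_im (z w : ℂ) : inner ℝ z w = z.re * w.re + z.im * w.im := by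
  simp [Complex.inner]; ring

lemma convexHull_triple {s a t z : ℂ} {x y w : ℝ} (hx : 0 ≤ x) (hy : 0 ≤ y) (hw : 0 ≤ w)
    (h1 : x + y + w = 1) (hz : z = x • s + y • a + w • t) : z ∈ convexHull ℝ {s, a, t} := by
  have hs : s ∈ convexHull ℝ ({s, a, t} : Set ℂ) := subset_convexHull ℝ _ (by simp)
  have ha : a ∈ convexHull ℝ ({s, a, t} : Set ℂ) := subset_convexHull ℝ _ (by simp)
  have ht : t ∈ convexHull ℝ ({s, a, t} : Set ℂ) := subset_convexHull ℝ _ (by simp)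
  rw [hz]
  rcases eq_or_lt_of_le (add_nonneg hx hy) with h | h
  · obtain rfl : x = 0 := by linarith
    obtain rfl : y = 0 := by linarith
    obtain rfl : w = 1 := by linarith
    simpa using ht
  · have h2 := convex_convexHull ℝ {s, a, t} hs ha (div_nonneg hx h.le) (div_nonneg hy h.le)
      (by rw [← add_div, div_self h.ne'])
    have h3 := convex_convexHull ℝ {s, a, t} h2 ht h.le hw h1
    rw [smul_add, smul_smul, smul_smul, mul_div_cancel₀ _ h.ne', mul_div_cancel₀ _ h.ne'] at h3
    exact h3

/-- The arc rounding a corner with tangent points `c + r • dir (ψ ± h)` lies on a circle. -/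
lemma roundingArc_eq {c s a t : ℂ} {r ψ h : ℝ} (hr : 0 < r) (h0 : 0 < h) (h1 : h < Real.pi / 2)
    (hs : s = c + r • dir (ψ + h)) (ht : t = c + r • dir (ψ - h))
    (ha : a = c + (r / Real.cos h) • dir ψ) :
    roundingArc s a t = {z | z ∈ convexHull ℝ {s, a, t} ∧ dist z c = r} := by
  have hc : 0 < Real.cos h := Real.cos_pos_of_mem_Ioo ⟨by linarith, h1⟩
  have hsn : 0 < Real.sin h := Real.sin_pos_of_pos_of_lt_pi h0 (by linarith)
  have hsq := Real.sin_sq_add_cos_sq h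
  have has : a - s = (r * Real.sin h / Real.cos h) • (⟨Real.sin (ψ + h), -Real.cos (ψ + h)⟩ : ℂ) := by
    rw [ha, hs]
    apply Complex.ext
    · simp only [Complex.add_re, Complex.add_im, Complex.sub_re, Complex.sub_im, Complex.smul_re, Complex.smul_im,
        dir_re, dir_im, smul_eq_mul, Real.sin_add, Real.cos_add, Real.sin_sub, Real.cos_sub]
      field_simp
      linear_combination (-r * Real.cos ψ) * hsq
    · simp only [Complex.add_re, Complex.add_im, Complex.sub_re, Complex.sub_im, Complex.smul_re, Complex.smul_im,
        dir_re, dir_im, smul_eq_mul, Real.sin_add, Real.cos_add, Real.sin_sub, Real.cos_sub]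
      field_simp
      linear_combination (-r * Real.sin ψ) * hsq
  have hat : a - t = (r * Real.sin h / Real.cos h) • (⟨-Real.sin (ψ - h), Real.cos (ψ - h)⟩ : ℂ) := by
    rw [ha, ht]
    apply Complex.ext
    · simp only [Complex.add_re, Complex.add_im, Complex.sub_re, Complex.sub_im, Complex.smul_re, Complex.smul_im,
        dir_re, dir_im, smul_eq_mul, Real.sin_add, Real.cos_add, Real.sin_sub, Real.cos_sub]
      field_simp
      linear_combination (-r * Real.cos ψ) * hsq
    · simp only [Complex.add_re, Complex.add_im, Complex.sub_re, Complex.sub_im, Complex.smul_re, Complex.smul_im,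
        dir_re, dir_im, smul_eq_mul, Real.sin_add, Real.cos_add, Real.sin_sub, Real.cos_sub]
      field_simp
      linear_combination (-r * Real.sin ψ) * hsq
  have hk : r * Real.sin h / Real.cos h ≠ 0 := by positivity
  have hsr : dist s c = r := by
    rw [hs, dist_eq_norm, add_sub_cancel_left, norm_smul, norm_dir]; simp [abs_of_pos hr]
  have htr : dist t c = r := by
    rw [ht, dist_eq_norm, add_sub_cancel_left, norm_smul, norm_dir]; simp [abs_of_pos hr]
  ext z
  simp only [roundingArc, mem_ofPred_eq]
  refine and_congr_right fun _ => ⟨?_, ?_⟩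
  · rintro ⟨c', h₁, h₂, hz⟩
    have e1 := h₁.inner_left_eq_zero_of_mem (left_mem_affineSpan_pair ℝ a s)
    have e2 := h₂.inner_left_eq_zero_of_mem (left_mem_affineSpan_pair ℝ a t)
    simp only [vsub_eq_sub] at e1 e2
    rw [has, inner_smul_left, inner_eq_re_im] at e1
    rw [hat, inner_smul_left, inner_eq_re_im] at e2
    have e1' := (mul_eq_zero.1 e1).resolve_left (by simpa using hk)
    have e2' := (mul_eq_zero.1 e2).resolve_left (by simpa using hk)
    rw [hs] at e1'
    rw [ht] at e2'
    simp at e1' e2'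
    -- The two tangency conditions are linear equations for the centre; their determinant is sin 2h,
    -- so the centre is unique.
    have hdet : Real.sin (ψ + h) * Real.cos (ψ - h) - Real.cos (ψ + h) * Real.sin (ψ - h)
        = 2 * Real.sin h * Real.cos h := by
      rw [← Real.sin_sub, ← Real.sin_two_mul]; ring_nf
    have hd : 2 * Real.sin h * Real.cos h ≠ 0 := by positivity
    have hcc : c'.center = c := by
      apply Complex.ext
      · have : (2 * Real.sin h * Real.cos h) * (c'.center.re - c.re) = 0 := by
          rw [← hdet]
          linear_combination (-Real.cos (ψ - h)) * e1' - Real.cos (ψ + h) * e2'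
        linarith [(mul_eq_zero.1 this).resolve_left hd]
      · have : (2 * Real.sin h * Real.cos h) * (c'.center.im - c.im) = 0 := by
          rw [← hdet]
          linear_combination (-Real.sin (ψ - h)) * e1' - Real.sin (ψ + h) * e2'
        linarith [(mul_eq_zero.1 this).resolve_left hd]
    have hm := h₁.mem_sphere
    rw [EuclideanGeometry.mem_sphere, hcc] at hm hz
    rw [hz, ← hm, hsr]
  · intro hz
    refine ⟨⟨c, r⟩, ⟨hsr, right_mem_affineSpan_pair ℝ a s, ?_⟩,
      ⟨htr, right_mem_affineSpan_pair ℝ a t, ?_⟩, hz⟩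
    · refine affineSpan_le.2 (insert_subset_iff.2 ⟨?_, singleton_subset_iff.2
        (EuclideanGeometry.Sphere.self_mem_orthRadius _ _)⟩)
      rw [SetLike.mem_coe]
      rw [EuclideanGeometry.Sphere.mem_orthRadius_iff_inner_left]
      simp only [vsub_eq_sub]
      rw [has, inner_smul_left, inner_eq_re_im, hs]
      simp; right; ring
    · refine affineSpan_le.2 (insert_subset_iff.2 ⟨?_, singleton_subset_iff.2
        (EuclideanGeometry.Sphere.self_mem_orthRadius _ _)⟩)
      rw [SetLike.mem_coe]
      rw [EuclideanGeometry.Sphere.mem_orthRadius_iff_inner_left]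
      simp only [vsub_eq_sub]
      rw [hat, inner_smul_left, inner_eq_re_im, ht]
      simp; right; ring

/-- The points `c + r • dir (ψ + u)` with `|u| ≤ h` belong to the arc rounding the corner. -/
lemma mem_convexHull_of_mem_circle {c s a t : ℂ} {r ψ h u : ℝ} (h0 : 0 < h)
    (h1 : h < Real.pi / 2) (hu : |u| ≤ h)
    (hs : s = c + r • dir (ψ + h)) (ht : t = c + r • dir (ψ - h))
    (ha : a = c + (r / Real.cos h) • dir ψ) :
    c + r • dir (ψ + u) ∈ convexHull ℝ {s, a, t} := by
  have hc : 0 < Real.cos h := Real.cos_pos_of_mem_Ioo ⟨by linarith, h1⟩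
  have hsn : 0 < Real.sin h := Real.sin_pos_of_pos_of_lt_pi h0 (by linarith)
  have hsq := Real.sin_sq_add_cos_sq h
  have hcu : Real.cos h ≤ Real.cos u := by
    rw [← Real.cos_abs u]
    exact Real.cos_le_cos_of_nonneg_of_le_pi (abs_nonneg u) (by linarith) hu
  -- Barycentric coordinates, solved in the frame where `c = 0`, `r = 1`, `ψ = 0`. Only the weight
  -- of `a` needs `|u| ≤ h` for its sign.
  refine convexHull_triple (x := (1 - Real.cos (u + h)) / (2 * Real.sin h ^ 2))
    (y := Real.cos h * (Real.cos u - Real.cos h) / Real.sin h ^ 2)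
    (w := (1 - Real.cos (u - h)) / (2 * Real.sin h ^ 2))
    (div_nonneg (by linarith [Real.cos_le_one (u + h)]) (by positivity))
    (div_nonneg (mul_nonneg hc.le (by linarith)) (by positivity))
    (div_nonneg (by linarith [Real.cos_le_one (u - h)]) (by positivity)) ?_ ?_
  · rw [Real.cos_add, Real.cos_sub]; field_simp
    linear_combination (-2) * hsq
  · rw [hs, ht, ha]
    have hsq' : Real.cos h ^ 2 = 1 - Real.sin h ^ 2 := by linarith
    apply Complex.ext
    · simp only [Complex.add_re, Complex.add_im, Complex.sub_re, Complex.sub_im, Complex.smul_re, Complex.smul_im,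
        dir_re, dir_im, smul_eq_mul, Real.sin_add, Real.cos_add, Real.sin_sub, Real.cos_sub]
      field_simp; ring_nf
      simp only [hsq']; ring
    · simp only [Complex.add_re, Complex.add_im, Complex.sub_re, Complex.sub_im, Complex.smul_re, Complex.smul_im,
        dir_re, dir_im, smul_eq_mul, Real.sin_add, Real.cos_add, Real.sin_sub, Real.cos_sub]
      field_simp; ring_nf
      simp only [hsq']; ring

/-! ### Angles, gaps and normals of the polygon. -/

/-- Sequences of angles that decrease to zero geometrically, together with their gaps. -/
structure Admissible (α : ℕ → ℝ) (κ : ℝ) : Prop where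
  one : α 1 = Real.pi / 2
  pos : ∀ n ≥ 1, 0 < α n
  lt_one : κ < 1
  contract : ∀ n ≥ 1, α (n + 1) ≤ κ * α n
  -- Decreasing gaps put `S (n + 1)` between `A (n + 1)` and `T n`; the fixed factor keeps the
  -- segment between `T n` and `S (n + 1)` comparable to its normal angle for `n ≥ 1`.
  gap : ∀ n ≥ 1, α (n + 1) - α (n + 2) ≤ κ * (α n - α (n + 1))

/-- The argument of the vertex `A n`. -/
noncomputable def ang (α : ℕ → ℝ) : ℕ → ℝ
  -- The mirror image of `A 2`; this makes the first two sides symmetric, so `hgap α 0 = hgap α 1`.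
  | 0 => Real.pi - α 2
  | n + 1 => α (n + 1)

/-- The normal direction of the side from `A n` to `A (n + 1)`. -/
noncomputable def nrm (α : ℕ → ℝ) (n : ℕ) : ℝ := (ang α n + ang α (n + 1)) / 2

/-- Half of the angle that the side from `A n` to `A (n + 1)` subtends at the origin. -/
noncomputable def hgap (α : ℕ → ℝ) (n : ℕ) : ℝ := (ang α n - ang α (n + 1)) / 2

lemma ang_eq_nrm_add (α : ℕ → ℝ) (n : ℕ) : ang α n = nrm α n + hgap α n := by
  simp only [nrm, hgap]; ring

lemma ang_succ_eq_nrm_sub (α : ℕ → ℝ) (n : ℕ) : ang α (n + 1) = nrm α n - hgap α n := by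
  simp only [nrm, hgap]; ring

lemma nrm_sub (α : ℕ → ℝ) (n : ℕ) :
    nrm α n - nrm α (n + 1) = hgap α n + hgap α (n + 1) := by
  simp only [nrm, hgap]; ring

lemma A_eq_dir (α : ℕ → ℝ) (n : ℕ) : A α n = dir (ang α n) := by
  cases n with
  | zero =>
    simp only [A, ang, exp_eq_dir]
    apply Complex.ext <;> simp [Real.cos_pi_sub, Real.sin_pi_sub]
  | succ n => simp only [A, ang, ← exp_eq_dir]

namespace Admissible

variable {α : ℕ → ℝ} {κ : ℝ}

lemma nonneg (hα : Admissible α κ) : 0 ≤ κ := by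
  have h1 := hα.contract 1 le_rfl
  have h2 := hα.pos 2 (by norm_num)
  have h3 := hα.pos 1 le_rfl
  norm_num at h1
  by_contra h
  push Not at h
  nlinarith

lemma succ_lt (hα : Admissible α κ) {n : ℕ} (hn : 1 ≤ n) : α (n + 1) < α n := by
  nlinarith [hα.contract n hn, hα.pos n hn, hα.lt_one]

lemma ang_pos (hα : Admissible α κ) (n : ℕ) : 0 < ang α n := by
  cases n with
  | zero =>
    have := hα.succ_lt le_rfl
    rw [hα.one] at this
    simp only [ang]
    norm_num at this
    linarith [Real.pi_pos]
  | succ n => exact hα.pos _ (by omega)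

lemma hgap_zero (hα : Admissible α κ) : hgap α 0 = hgap α 1 := by
  simp only [hgap, ang, hα.one]; ring

lemma hgap_pos (hα : Admissible α κ) (n : ℕ) : 0 < hgap α n := by
  cases n with
  | zero =>
    rw [hα.hgap_zero]
    have := hα.succ_lt le_rfl
    simp only [hgap, ang]; linarith
  | succ n =>
    have := hα.succ_lt (n := n + 1) (by omega)
    simp only [hgap, ang]; linarith

lemma hgap_contract (hα : Admissible α κ) (n : ℕ) : hgap α (n + 2) ≤ κ * hgap α (n + 1) := by
  have := hα.gap (n + 1) (by omega)
  simp only [hgap, ang]; linarith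

lemma hgap_succ_le (hα : Admissible α κ) (n : ℕ) : hgap α (n + 1) ≤ hgap α n := by
  cases n with
  | zero => exact hα.hgap_zero.ge
  | succ n => nlinarith [hα.hgap_contract n, hα.hgap_pos (n + 1), hα.lt_one]

lemma ang_anti (hα : Admissible α κ) : StrictAnti (ang α) :=
  strictAnti_nat_of_succ_lt fun n => by
    have := hα.hgap_pos n
    simp only [hgap] at this; linarith

lemma ang_lt_pi (hα : Admissible α κ) (n : ℕ) : ang α n < Real.pi := by
  have := hα.ang_anti.antitone (Nat.zero_le n)
  have h2 := hα.pos 2 (by norm_num)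
  simp only [ang] at this ⊢
  linarith

/-- The half-gaps do not increase, and the initial one is π/4 − α 2 / 2. -/
lemma hgap_lt (hα : Admissible α κ) (n : ℕ) : hgap α n < Real.pi / 4 := by
  have h0 : hgap α n ≤ hgap α 0 := antitone_nat_of_succ_le hα.hgap_succ_le (Nat.zero_le n)
  have h2 := hα.pos 2 (by norm_num)
  simp only [hgap, ang, hα.one] at h0 ⊢
  linarith

lemma nrm_pos (hα : Admissible α κ) (n : ℕ) : 0 < nrm α n := by
  have := hα.ang_pos n
  have := hα.ang_pos (n + 1)
  simp only [nrm]; linarith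

lemma nrm_anti (hα : Admissible α κ) : StrictAnti (nrm α) :=
  strictAnti_nat_of_succ_lt fun n => by
    linarith [nrm_sub α n, hα.hgap_pos n, hα.hgap_pos (n + 1)]

lemma nrm_succ_lt (hα : Admissible α κ) (n : ℕ) : nrm α (n + 1) < Real.pi / 2 := by
  have h := hα.nrm_anti.antitone (Nat.le_add_left 1 n)
  have h2 : nrm α 1 = nrm α 0 - hgap α 0 - hgap α 1 := by linarith [nrm_sub α 0]
  have h3 := hα.hgap_pos 1
  have h4 : nrm α 0 = Real.pi / 2 + hgap α 0 := by
    simp only [nrm, hgap, ang, hα.one]; ring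
  linarith

lemma half_pi_le_nrm_zero (hα : Admissible α κ) : Real.pi / 2 ≤ nrm α 0 := by
  have h3 := hα.hgap_pos 0
  have h4 : nrm α 0 = Real.pi / 2 + hgap α 0 := by
    simp only [nrm, hgap, ang, hα.one]; ring
  linarith

lemma sin_hgap_pos (hα : Admissible α κ) (n : ℕ) : 0 < Real.sin (hgap α n) :=
  Real.sin_pos_of_pos_of_lt_pi (hα.hgap_pos n) (by linarith [hα.hgap_lt n, Real.pi_pos])

lemma sin_hgap_succ_le (hα : Admissible α κ) (n : ℕ) :
    Real.sin (hgap α (n + 1)) ≤ Real.sin (hgap α n) :=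
  Real.sin_le_sin_of_le_of_le_pi_div_two (by linarith [hα.hgap_pos (n + 1), Real.pi_pos])
    (by linarith [hα.hgap_lt n, Real.pi_pos]) (hα.hgap_succ_le n)

end Admissible

/-! ### Tangent points, centres and radii of the arcs. -/

lemma dir_add_sub_dir_sub (φ δ : ℝ) :
    dir (φ + δ) - dir (φ - δ) = (2 * Real.sin δ) • (⟨-Real.sin φ, Real.cos φ⟩ : ℂ) := by
  apply Complex.ext
  · simp only [Complex.add_re, Complex.add_im, Complex.sub_re, Complex.sub_im, Complex.smul_re,
      Complex.smul_im, dir_re, dir_im, smul_eq_mul, Real.cos_add, Real.cos_sub]; ring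
  · simp only [Complex.add_re, Complex.add_im, Complex.sub_re, Complex.sub_im, Complex.smul_re,
      Complex.smul_im, dir_re, dir_im, smul_eq_mul, Real.sin_add, Real.sin_sub]; ring

lemma norm_perp (φ : ℝ) : ‖(⟨-Real.sin φ, Real.cos φ⟩ : ℂ)‖ = 1 := by
  rw [show (⟨-Real.sin φ, Real.cos φ⟩ : ℂ) = dir (φ + Real.pi / 2) from
    Complex.ext (by simp [Real.cos_add_pi_div_two]) (by simp [Real.sin_add_pi_div_two]), norm_dir]

/-- The midpoint of a chord of the unit circle is the foot of the perpendicular from the origin. -/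
lemma T_eq_dir (α : ℕ → ℝ) (n : ℕ) : T α n = Real.cos (hgap α n) • dir (nrm α n) := by
  rw [T, A_eq_dir, A_eq_dir, ang_succ_eq_nrm_sub, ang_eq_nrm_add, midpoint_eq_smul_add, invOf_eq_inv]
  apply Complex.ext
  · simp only [Complex.add_re, Complex.add_im, Complex.sub_re, Complex.sub_im, Complex.smul_re,
      Complex.smul_im, dir_re, dir_im, smul_eq_mul, Real.cos_add, Real.cos_sub]; ring
  · simp only [Complex.add_re, Complex.add_im, Complex.sub_re, Complex.sub_im, Complex.smul_re,
      Complex.smul_im, dir_re, dir_im, smul_eq_mul, Real.sin_add, Real.sin_sub]; ring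

lemma dist_A_succ {α : ℕ → ℝ} {κ : ℝ} (hα : Admissible α κ) (n : ℕ) :
    dist (A α n) (A α (n + 1)) = 2 * Real.sin (hgap α n) := by
  rw [A_eq_dir, A_eq_dir, ang_succ_eq_nrm_sub, ang_eq_nrm_add, dist_eq_norm, dir_add_sub_dir_sub,
    norm_smul, norm_perp, mul_one, Real.norm_eq_abs,
    abs_of_pos (mul_pos two_pos (hα.sin_hgap_pos n))]

/-- The position of `S (n + 1)` on the side from `A (n + 1)` to `A n`. -/
noncomputable def wgt (α : ℕ → ℝ) (n : ℕ) : ℝ :=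
  Real.sin (hgap α (n + 1)) / (2 * Real.sin (hgap α n))

lemma wgt_pos {α : ℕ → ℝ} {κ : ℝ} (hα : Admissible α κ) (n : ℕ) : 0 < wgt α n :=
  div_pos (hα.sin_hgap_pos _) (mul_pos two_pos (hα.sin_hgap_pos n))

/-- Thus `S (n + 1)` does not pass the midpoint `T n`, and the roundings of neighbouring corners do
not overlap. -/
lemma wgt_le {α : ℕ → ℝ} {κ : ℝ} (hα : Admissible α κ) (n : ℕ) : wgt α n ≤ 1 / 2 := by
  have := hα.sin_hgap_pos n
  rw [wgt, div_le_div_iff₀ (by positivity) two_pos]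
  linarith [hα.sin_hgap_succ_le n]

lemma S_succ_eq {α : ℕ → ℝ} {κ : ℝ} (hα : Admissible α κ) (n : ℕ) :
    S α (n + 1) = (1 - wgt α n) • A α (n + 1) + wgt α n • A α n := by
  rw [S, T, dist_left_midpoint, dist_A_succ hα, Nat.add_sub_cancel, dist_comm (A α (n + 1)),
    dist_A_succ hα, AffineMap.lineMap_apply_module, wgt, Real.norm_ofNat, inv_mul_cancel_left₀ two_ne_zero]

lemma S_succ_eq_A_add {α : ℕ → ℝ} {κ : ℝ} (hα : Admissible α κ) (n : ℕ) :
    S α (n + 1) = dir (ang α (n + 1)) +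
      Real.sin (hgap α (n + 1)) • (⟨-Real.sin (nrm α n), Real.cos (nrm α n)⟩ : ℂ) := by
  have h := dir_add_sub_dir_sub (nrm α n) (hgap α n)
  rw [← ang_eq_nrm_add, ← ang_succ_eq_nrm_sub] at h
  have h2 := (hα.sin_hgap_pos n).ne'
  have h3 : Real.sin (hgap α (n + 1)) = wgt α n * (2 * Real.sin (hgap α n)) := by
    rw [wgt]; field_simp
  rw [h3, mul_smul, ← h, S_succ_eq hα, A_eq_dir, A_eq_dir]
  module

lemma S_succ_eq_T_sub {α : ℕ → ℝ} {κ : ℝ} (hα : Admissible α κ) (n : ℕ) :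
    S α (n + 1) = T α n - (Real.sin (hgap α n) - Real.sin (hgap α (n + 1))) •
      (⟨-Real.sin (nrm α n), Real.cos (nrm α n)⟩ : ℂ) := by
  rw [S_succ_eq_A_add hα, T_eq_dir, ang_succ_eq_nrm_sub]
  apply Complex.ext
  · simp only [Complex.add_re, Complex.add_im, Complex.sub_re, Complex.sub_im, Complex.smul_re,
      Complex.smul_im, dir_re, dir_im, smul_eq_mul, Real.cos_sub]; ring
  · simp only [Complex.add_re, Complex.add_im, Complex.sub_re, Complex.sub_im, Complex.smul_re,
      Complex.smul_im, dir_re, dir_im, smul_eq_mul, Real.sin_sub]; ring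

/-- Half of the turning angle at the vertex `A (n + 1)`. -/
noncomputable def turn (α : ℕ → ℝ) (n : ℕ) : ℝ := (nrm α n - nrm α (n + 1)) / 2

/-- The radius of the arc rounding the vertex `A (n + 1)`. -/
noncomputable def arcR (α : ℕ → ℝ) (n : ℕ) : ℝ :=
  -- The tangent length, radius times tan `turn α n`, must be half the next side, sin `hgap α (n +
  -- 1)`.
  Real.sin (hgap α (n + 1)) * Real.cos (turn α n) / Real.sin (turn α n)

/-- The centre of the arc rounding the vertex `A (n + 1)`. -/
noncomputable def arcC (α : ℕ → ℝ) (n : ℕ) : ℂ := T α (n + 1) - arcR α n • dir (nrm α (n + 1))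

lemma turn_pos {α : ℕ → ℝ} {κ : ℝ} (hα : Admissible α κ) (n : ℕ) : 0 < turn α n := by
  have := hα.nrm_anti (Nat.lt_succ_self n)
  simp only [turn]; linarith

lemma turn_le {α : ℕ → ℝ} {κ : ℝ} (hα : Admissible α κ) (n : ℕ) : turn α n ≤ hgap α n := by
  simp only [turn, nrm_sub]; linarith [hα.hgap_succ_le n]

lemma turn_lt {α : ℕ → ℝ} {κ : ℝ} (hα : Admissible α κ) (n : ℕ) : turn α n < Real.pi / 4 :=
  (turn_le hα n).trans_lt (hα.hgap_lt n)

lemma cos_turn_pos {α : ℕ → ℝ} {κ : ℝ} (hα : Admissible α κ) (n : ℕ) :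
    0 < Real.cos (turn α n) :=
  Real.cos_pos_of_mem_Ioo ⟨by linarith [turn_pos hα n, Real.pi_pos],
    by linarith [turn_lt hα n, Real.pi_pos]⟩

lemma sin_turn_pos {α : ℕ → ℝ} {κ : ℝ} (hα : Admissible α κ) (n : ℕ) :
    0 < Real.sin (turn α n) :=
  Real.sin_pos_of_pos_of_lt_pi (turn_pos hα n) (by linarith [turn_lt hα n, Real.pi_pos])

lemma arcR_pos {α : ℕ → ℝ} {κ : ℝ} (hα : Admissible α κ) (n : ℕ) : 0 < arcR α n :=
  div_pos (mul_pos (hα.sin_hgap_pos _) (cos_turn_pos hα n)) (sin_turn_pos hα n)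

lemma T_succ_eq_arcC (α : ℕ → ℝ) (n : ℕ) :
    T α (n + 1) = arcC α n + arcR α n • dir (nrm α (n + 1)) := by
  simp [arcC]

lemma A_succ_eq_arcC {α : ℕ → ℝ} {κ : ℝ} (hα : Admissible α κ) (n : ℕ) :
    A α (n + 1) = arcC α n +
      (arcR α n / Real.cos (turn α n)) • dir ((nrm α n + nrm α (n + 1)) / 2) := by
  have hs := (sin_turn_pos hα n).ne'
  have hc := (cos_turn_pos hα n).ne'
  have h1 : (nrm α n + nrm α (n + 1)) / 2 = nrm α (n + 1) + turn α n := by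
    simp only [turn]; ring
  have hsq := Real.sin_sq_add_cos_sq (turn α n)
  rw [A_eq_dir, arcC, T_eq_dir, ang_eq_nrm_add, h1, arcR]
  apply Complex.ext <;>
  · simp only [Complex.add_re, Complex.add_im, Complex.sub_re, Complex.sub_im, Complex.smul_re,
      Complex.smul_im, dir_re, dir_im, smul_eq_mul, Real.sin_add, Real.cos_add]
    field_simp
    ring

lemma S_succ_eq_arcC {α : ℕ → ℝ} {κ : ℝ} (hα : Admissible α κ) (n : ℕ) :
    S α (n + 1) = arcC α n + arcR α n • dir (nrm α n) := by
  have hs := (sin_turn_pos hα n).ne'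
  have hc := (cos_turn_pos hα n).ne'
  have h1 : (nrm α n + nrm α (n + 1)) / 2 = nrm α n - turn α n := by
    simp only [turn]; ring
  have h := A_succ_eq_arcC hα n
  rw [A_eq_dir] at h
  rw [S_succ_eq_A_add hα, h, h1, arcR]
  apply Complex.ext <;>
  · simp only [Complex.add_re, Complex.add_im, Complex.sub_re, Complex.sub_im, Complex.smul_re,
      Complex.smul_im, dir_re, dir_im, smul_eq_mul, Real.sin_sub, Real.cos_sub]
    field_simp
    ring

lemma arc_succ_eq {α : ℕ → ℝ} {κ : ℝ} (hα : Admissible α κ) (n : ℕ) :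
    arc α (n + 1) = {z | z ∈ convexHull ℝ {S α (n + 1), A α (n + 1), T α (n + 1)} ∧
      dist z (arcC α n) = arcR α n} := by
  refine roundingArc_eq (ψ := (nrm α n + nrm α (n + 1)) / 2) (arcR_pos hα n) (turn_pos hα n)
    (by linarith [turn_lt hα n, Real.pi_pos]) ?_ ?_ (A_succ_eq_arcC hα n)
  · rw [S_succ_eq_arcC hα, turn]; ring_nf
  · rw [T_succ_eq_arcC, turn]; ring_nf

lemma mem_arc_succ {α : ℕ → ℝ} {κ : ℝ} (hα : Admissible α κ) {n : ℕ} {φ : ℝ}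
    (hφ : φ ∈ Icc (nrm α (n + 1)) (nrm α n)) :
    arcC α n + arcR α n • dir φ ∈ arc α (n + 1) := by
  rw [arc_succ_eq hα]
  refine ⟨?_, ?_⟩
  · have := mem_convexHull_of_mem_circle (c := arcC α n) (r := arcR α n)
      (u := φ - (nrm α n + nrm α (n + 1)) / 2) (ψ := (nrm α n + nrm α (n + 1)) / 2)
      (turn_pos hα n) (by linarith [turn_lt hα n, Real.pi_pos])
      (abs_le.2 ⟨by simp only [turn]; linarith [hφ.1], by simp only [turn]; linarith [hφ.2]⟩)
      (s := S α (n + 1)) (t := T α (n + 1))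
      (by rw [S_succ_eq_arcC hα, turn]; ring_nf) (by rw [T_succ_eq_arcC, turn]; ring_nf)
      (A_succ_eq_arcC hα n)
    simpa using this
  · rw [dist_eq_norm, add_sub_cancel_left, norm_smul, norm_dir]
    simp [abs_of_pos (arcR_pos hα n)]

/-! ### Supporting lines of `J₁`. -/

/-- The linear functional `⟨dir φ, ·⟩`. -/
noncomputable def supp (φ : ℝ) (z : ℂ) : ℝ := z.re * Real.cos φ + z.im * Real.sin φ

lemma supp_add (φ : ℝ) (z w : ℂ) : supp φ (z + w) = supp φ z + supp φ w := by
  simp only [supp, Complex.add_re, Complex.add_im]; ring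

lemma supp_smul (φ c : ℝ) (z : ℂ) : supp φ (c • z) = c * supp φ z := by
  simp only [supp, Complex.smul_re, Complex.smul_im, smul_eq_mul]; ring

lemma supp_dir (φ a : ℝ) : supp φ (dir a) = Real.cos (a - φ) := by
  simp only [supp, dir_re, dir_im, Real.cos_sub]

lemma supp_dir_self (φ : ℝ) : supp φ (dir φ) = 1 := by simp [supp_dir]

lemma supp_le_norm (φ : ℝ) (z : ℂ) : supp φ z ≤ ‖z‖ := by
  have h := real_inner_le_norm (dir φ) z
  rw [norm_dir, one_mul, inner_eq_re_im] at h
  simp only [supp]; simp only [dir_re, dir_im] at h; linarith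

lemma convex_supp_le (φ M : ℝ) : Convex ℝ {z | supp φ z ≤ M} := by
  intro z hz w hw a b ha hb hab
  simp only [mem_ofPred_eq, supp_add, supp_smul] at *
  calc a * supp φ z + b * supp φ w ≤ a * M + b * M := by gcongr
    _ = M := by rw [← add_mul, hab, one_mul]

lemma cos_le_cos_of_abs {x y : ℝ} (h : |x| ≤ |y|) (hy : |y| ≤ Real.pi) :
    Real.cos y ≤ Real.cos x := by
  rw [← Real.cos_abs x, ← Real.cos_abs y]
  exact Real.cos_le_cos_of_nonneg_of_le_pi (abs_nonneg x) hy h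

/-- `J₁` lies on one side of the tangents of the arc rounding the vertex `A (n + 1)`. -/
lemma supp_le_of_mem_J₁ {α : ℕ → ℝ} {κ : ℝ} (hα : Admissible α κ) {n : ℕ} {φ : ℝ}
    (hφ : φ ∈ Icc (nrm α (n + 1)) (nrm α n)) (hφ2 : φ ≤ Real.pi / 2) {z : ℂ} (hz : z ∈ J₁ α) :
    supp φ z ≤ supp φ (arcC α n + arcR α n • dir φ) := by
  have hpi := Real.pi_pos
  set M := supp φ (arcC α n + arcR α n • dir φ) with hM
  have hr := arcR_pos hα n
  have hM' : M = supp φ (arcC α n) + arcR α n := by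
    rw [hM, supp_add, supp_smul, supp_dir_self, mul_one]
  have hdisc : ∀ w, dist w (arcC α n) = arcR α n → supp φ w ≤ M := by
    intro w hw
    have := supp_le_norm φ (w - arcC α n)
    rw [← dist_eq_norm, hw] at this
    rw [hM', show w = arcC α n + (w - arcC α n) by ring, supp_add]; linarith
  have hφ0 : 0 < φ := (hα.nrm_pos _).trans_le hφ.1
  have hup : φ ≤ ang α n := by
    have := hα.hgap_pos n
    rw [ang_eq_nrm_add]; linarith [hφ.2]
  have hlow : ang α (n + 2) ≤ φ := by
    have := hα.hgap_pos (n + 1)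
    rw [ang_succ_eq_nrm_sub]; linarith [hφ.1]
  have hmid : ang α (n + 1) ≤ ang α n := hα.ang_anti.antitone (Nat.le_succ n)
  have hmid' : ang α (n + 2) ≤ ang α (n + 1) := hα.ang_anti.antitone (Nat.le_succ (n + 1))
  have h1 := hφ.1
  have h2 := hφ.2
  simp only [nrm] at h1 h2
  -- the functional decreases away from the vertex `A (n + 1)`
  have hA : ∀ k, supp φ (A α k) = Real.cos (ang α k - φ) := fun k => by rw [A_eq_dir, supp_dir]
  have hup1 : supp φ (A α n) ≤ supp φ (A α (n + 1)) := by
    rw [hA, hA]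
    refine cos_le_cos_of_abs ?_ ?_
    · rw [abs_of_nonneg (by linarith : (0:ℝ) ≤ ang α n - φ)]
      exact abs_le.2 ⟨by linarith, by linarith⟩
    · exact abs_le.2 ⟨by linarith, by linarith [hα.ang_lt_pi n]⟩
  have hlow1 : supp φ (A α (n + 2)) ≤ supp φ (A α (n + 1)) := by
    rw [hA, hA]
    refine cos_le_cos_of_abs ?_ ?_
    · rw [abs_of_nonpos (by linarith : ang α (n + 2) - φ ≤ 0)]
      exact abs_le.2 ⟨by linarith, by linarith⟩
    · exact abs_le.2 ⟨by linarith [hα.ang_pos (n + 2)], by linarith⟩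
  have hS : ∀ m, supp φ (S α (m + 1)) = (1 - wgt α m) * supp φ (A α (m + 1)) +
      wgt α m * supp φ (A α m) := fun m => by
    rw [S_succ_eq hα, supp_add, supp_smul, supp_smul]
  have hT : ∀ m, supp φ (T α m) = (supp φ (A α m) + supp φ (A α (m + 1))) / 2 := fun m => by
    rw [T, midpoint_eq_smul_add, supp_smul, supp_add]; norm_num; ring
  have hSn : supp φ (S α (n + 1)) ≤ M := hdisc _ (by
    rw [S_succ_eq_arcC hα, dist_eq_norm, add_sub_cancel_left, norm_smul, norm_dir]
    simp [abs_of_pos hr])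
  have hTn : supp φ (T α (n + 1)) ≤ M := hdisc _ (by
    rw [T_succ_eq_arcC, dist_eq_norm, add_sub_cancel_left, norm_smul, norm_dir]
    simp [abs_of_pos hr])
  have hwn := wgt_pos hα n
  have hwn' := wgt_le hα n
  -- Only the cut-off vertex `A (n + 1)` may exceed `M`. Its neighbours are bounded through `S (n +
  -- 1)` and `T (n + 1)`, which lie on the circle and are averages of `A (n + 1)` with a neighbour
  -- of smaller value.
  have hAn : supp φ (A α n) ≤ M := by
    refine le_trans ?_ hSn
    rw [hS]; nlinarith
  have hAn2 : supp φ (A α (n + 2)) ≤ M := by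
    refine le_trans ?_ hTn
    rw [hT]; linarith
  have hAk : ∀ k, k ≠ n + 1 → supp φ (A α k) ≤ M := by
    intro k hk
    rcases Nat.lt_or_gt_of_ne hk with hk | hk
    · refine le_trans ?_ hAn
      have hkn := hα.ang_anti.antitone (Nat.le_of_lt_succ hk)
      rw [hA, hA]
      exact Real.cos_le_cos_of_nonneg_of_le_pi (by linarith) (by linarith [hα.ang_lt_pi k])
        (by linarith)
    · refine le_trans ?_ hAn2
      have hkn := hα.ang_anti.antitone (show n + 2 ≤ k from hk)
      rw [hA, hA]
      refine cos_le_cos_of_abs ?_ (abs_le.2 ⟨by linarith [hα.ang_pos k], by linarith⟩)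
      rw [abs_of_nonpos (by linarith), abs_of_nonpos (by linarith)]
      linarith
  -- On the two sides that end at `A (n + 1)`, the remaining points `S (n + 2)` and `T n` are
  -- farther from that vertex than `T (n + 1)` and `S (n + 1)`, because the weights are at most 1/2.
  have hSm : ∀ m, supp φ (S α (m + 1)) ≤ M := by
    intro m
    have hw := wgt_pos hα m
    have hw' := wgt_le hα m
    by_cases hm : m = n
    · exact hm ▸ hSn
    by_cases hm' : m = n + 1
    · subst hm'
      refine le_trans ?_ hTn
      rw [hS, hT]; nlinarith
    · rw [hS]
      nlinarith [hAk m hm', hAk (m + 1) (by omega)]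
  have hTm : ∀ m, supp φ (T α m) ≤ M := by
    intro m
    by_cases hm : m = n
    · subst hm
      refine le_trans ?_ hSn
      rw [hS, hT]; nlinarith
    by_cases hm' : m = n + 1
    · exact hm' ▸ hTn
    · rw [hT]
      linarith [hAk m hm', hAk (m + 1) (by omega)]
  have h1M : Real.cos φ ≤ M := by
    refine le_trans ?_ hAn2
    rw [hA]
    have h3 := hα.ang_pos (n + 2)
    rw [← Real.cos_neg φ]
    refine cos_le_cos_of_abs ?_ (abs_le.2 ⟨by linarith, by linarith⟩)
    rw [abs_of_nonpos (by linarith), abs_of_nonpos (by linarith)]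
    linarith
  refine convexHull_min ?_ (convex_supp_le φ M) hz
  rintro w ((hw | hw) | hw)
  · rcases hw with rfl | rfl
    · have := Real.cos_nonneg_of_neg_pi_div_two_le_of_le (by linarith : -(Real.pi / 2) ≤ φ) hφ2
      simp only [mem_ofPred_eq, supp, Complex.zero_re, Complex.zero_im]; linarith
    · simp only [mem_ofPred_eq, supp, Complex.one_re, Complex.one_im]; linarith
  · simp only [mem_iUnion] at hw
    obtain ⟨m, hm, hw⟩ := hw
    obtain ⟨m, rfl⟩ : ∃ k, m = k + 1 := ⟨m - 1, by omega⟩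
    rw [arc_succ_eq hα] at hw
    by_cases hmn : m = n
    · subst hmn; exact hdisc w hw.2
    · refine convexHull_min ?_ (convex_supp_le φ M) hw.1
      rintro x (rfl | rfl | rfl)
      · exact hSm m
      · exact hAk _ (by omega)
      · exact hTm _
  · simp only [mem_iUnion] at hw
    obtain ⟨m, hm, hw⟩ := hw
    exact (convex_supp_le φ M).segment_subset (hTm m) (hSm m) hw

/-! ### Symmetry and convexity of `K`. -/

variable {α : ℕ → ℝ} {κ : ℝ}

lemma T_mem_J₁ (α : ℕ → ℝ) (n : ℕ) : T α (n + 1) ∈ J₁ α :=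
  subset_convexHull ℝ _ (Or.inr (mem_iUnion₂.2 ⟨n + 1, by omega, left_mem_segment ℝ _ _⟩))

lemma S_mem_J₁ (α : ℕ → ℝ) (n : ℕ) : S α (n + 2) ∈ J₁ α :=
  subset_convexHull ℝ _ (Or.inr (mem_iUnion₂.2 ⟨n + 1, by omega, right_mem_segment ℝ _ _⟩))

lemma segment_subset_J₁ (α : ℕ → ℝ) (n : ℕ) : segment ℝ (T α (n + 1)) (S α (n + 2)) ⊆ J₁ α :=
  (convex_convexHull ℝ _).segment_subset (T_mem_J₁ α n) (S_mem_J₁ α n)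

lemma arc_subset_J₁ (α : ℕ → ℝ) (n : ℕ) : arc α (n + 1) ⊆ J₁ α := fun _ hz =>
  subset_convexHull ℝ _ (Or.inl (Or.inr (mem_iUnion₂.2 ⟨n + 1, by omega, hz⟩)))

lemma zero_mem_J₁ (α : ℕ → ℝ) : 0 ∈ J₁ α := subset_convexHull ℝ _ (by simp)

lemma one_mem_J₁ (α : ℕ → ℝ) : 1 ∈ J₁ α := subset_convexHull ℝ _ (by simp)

lemma convex_J₁ (α : ℕ → ℝ) : Convex ℝ (J₁ α) := convex_convexHull ℝ _

lemma T_mem_of_convex {B : Set ℂ} (hB : Convex ℝ B) {n : ℕ} (h1 : A α n ∈ B)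
    (h2 : A α (n + 1) ∈ B) : T α n ∈ B :=
  hB.segment_subset h1 h2 (midpoint_mem_segment _ _)

lemma S_mem_of_convex (hα : Admissible α κ) {B : Set ℂ} (hB : Convex ℝ B) {n : ℕ}
    (h1 : A α n ∈ B) (h2 : A α (n + 1) ∈ B) : S α (n + 1) ∈ B := by
  rw [S_succ_eq hα]
  exact hB h2 h1 (by linarith [wgt_le hα n]) (wgt_pos hα n).le (by ring)

lemma arc_subset_of_convex (hα : Admissible α κ) {B : Set ℂ} (hB : Convex ℝ B) {n : ℕ}
    (h1 : A α n ∈ B) (h2 : A α (n + 1) ∈ B) (h3 : A α (n + 2) ∈ B) : arc α (n + 1) ⊆ B := by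
  intro z hz
  refine convexHull_min ?_ hB hz.1
  rintro x (rfl | rfl | rfl)
  exacts [S_mem_of_convex hα hB h1 h2, h2, T_mem_of_convex hB h2 h3]

lemma segment_subset_of_convex (hα : Admissible α κ) {B : Set ℂ} (hB : Convex ℝ B) {n : ℕ}
    (h1 : A α n ∈ B) (h2 : A α (n + 1) ∈ B) : segment ℝ (T α n) (S α (n + 1)) ⊆ B :=
  hB.segment_subset (T_mem_of_convex hB h1 h2) (S_mem_of_convex hα hB h1 h2)

/-- The arcs and segments lie in the hull of the vertices, so convex bounds need checking only
there. The vertex `A 0` is included because `S 1` lies on the side towards it. -/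
lemma J₁_subset_of_convex (hα : Admissible α κ) {B : Set ℂ} (hB : Convex ℝ B) (h0 : 0 ∈ B)
    (h1 : 1 ∈ B) (hA : ∀ k, A α k ∈ B) : J₁ α ⊆ B := by
  refine convexHull_min ?_ hB
  rintro w ((hw | hw) | hw)
  · rcases hw with rfl | rfl
    exacts [h0, h1]
  · simp only [mem_iUnion] at hw
    obtain ⟨m, hm, hw⟩ := hw
    obtain ⟨m, rfl⟩ : ∃ k, m = k + 1 := ⟨m - 1, by omega⟩
    exact arc_subset_of_convex hα hB (hA _) (hA _) (hA _) hw
  · simp only [mem_iUnion] at hw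
    obtain ⟨m, hm, hw⟩ := hw
    exact segment_subset_of_convex hα hB (hA _) (hA _) hw

lemma norm_le_one_of_mem_J₁ (hα : Admissible α κ) {z : ℂ} (hz : z ∈ J₁ α) : ‖z‖ ≤ 1 := by
  have := J₁_subset_of_convex hα (convex_closedBall (0 : ℂ) 1) (by simp) (by simp)
    (fun k => by simp [A_eq_dir, norm_dir]) hz
  simpa using this

lemma im_nonneg_of_mem_J₁ (hα : Admissible α κ) {z : ℂ} (hz : z ∈ J₁ α) : 0 ≤ z.im :=
  J₁_subset_of_convex hα (convex_halfSpace_im_ge 0) (by simp) (by simp)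
    (fun k => by
      simpa [A_eq_dir] using Real.sin_nonneg_of_nonneg_of_le_pi (hα.ang_pos k).le
        (hα.ang_lt_pi k).le) hz

/-- The height of the top point of the set. -/
noncomputable def topHeight (α : ℕ → ℝ) : ℝ := (arcC α 0).im + arcR α 0

lemma nrm_zero (hα : Admissible α κ) : nrm α 0 = Real.pi - nrm α 1 := by
  simp only [nrm, ang, hα.one]; ring

lemma arcC_zero_re (hα : Admissible α κ) : (arcC α 0).re = 0 := by
  have h := congrArg Complex.re (A_succ_eq_arcC hα 0)
  have h2 : (nrm α 0 + nrm α (0 + 1)) / 2 = Real.pi / 2 := by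
    rw [nrm_zero hα]; ring
  rw [h2, A_eq_dir] at h
  simp only [Complex.add_re, Complex.smul_re, dir_re, smul_eq_mul, Real.cos_pi_div_two, ang,
    zero_add, hα.one] at h
  linarith

lemma topPoint_eq (hα : Admissible α κ) :
    (⟨0, topHeight α⟩ : ℂ) = arcC α 0 + arcR α 0 • dir (Real.pi / 2) := by
  apply Complex.ext
  · simp only [Complex.add_re, Complex.smul_re, dir_re, smul_eq_mul, Real.cos_pi_div_two,
      arcC_zero_re hα]; ring
  · simp only [Complex.add_im, Complex.smul_im, dir_im, smul_eq_mul, Real.sin_pi_div_two,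
      topHeight]; ring

lemma half_pi_mem (hα : Admissible α κ) : Real.pi / 2 ∈ Icc (nrm α (0 + 1)) (nrm α 0) :=
  ⟨(hα.nrm_succ_lt 0).le, hα.half_pi_le_nrm_zero⟩

lemma topPoint_mem (hα : Admissible α κ) : (⟨0, topHeight α⟩ : ℂ) ∈ J₁ α := by
  rw [topPoint_eq hα]
  exact arc_subset_J₁ α 0 (mem_arc_succ hα (half_pi_mem hα))

lemma im_le_topHeight (hα : Admissible α κ) {z : ℂ} (hz : z ∈ J₁ α) : z.im ≤ topHeight α := by
  have := supp_le_of_mem_J₁ hα (half_pi_mem hα) le_rfl hz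
  rw [← topPoint_eq hα] at this
  simpa [supp] using this

lemma topHeight_pos (hα : Admissible α κ) : 0 < topHeight α := by
  refine lt_of_lt_of_le ?_ (im_le_topHeight hα (T_mem_J₁ α 0))
  rw [T_eq_dir]
  simp only [Complex.smul_im, dir_im, smul_eq_mul]
  have h1 := hα.hgap_pos (0 + 1)
  have h2 := hα.hgap_lt (0 + 1)
  have h3 := hα.nrm_pos (0 + 1)
  have h4 := hα.nrm_succ_lt 0
  exact mul_pos (Real.cos_pos_of_mem_Ioo ⟨by linarith, by linarith⟩)
    (Real.sin_pos_of_pos_of_lt_pi h3 (by linarith))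

lemma _root_.Convex.mk_mem_of_mem_Icc_im {C : Set ℂ} (hC : Convex ℝ C) {x y₁ y₂ y : ℝ}
    (h1 : (⟨x, y₁⟩ : ℂ) ∈ C) (h2 : (⟨x, y₂⟩ : ℂ) ∈ C) (hy : y ∈ Icc y₁ y₂) :
    (⟨x, y⟩ : ℂ) ∈ C := by
  have : Convex ℝ {y : ℝ | (⟨x, y⟩ : ℂ) ∈ C} := by
    intro u hu v hv a b ha hb hab
    have h := hC hu hv ha hb hab
    rw [mem_ofPred_eq]
    convert h using 1
    apply Complex.ext
    · simp [← add_mul, hab]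
    · simp
  exact this.ordConnected.out h1 h2 hy

lemma _root_.Convex.mk_mem_of_mem_Icc_re {C : Set ℂ} (hC : Convex ℝ C) {x₁ x₂ x y : ℝ}
    (h1 : (⟨x₁, y⟩ : ℂ) ∈ C) (h2 : (⟨x₂, y⟩ : ℂ) ∈ C) (hx : x ∈ Icc x₁ x₂) :
    (⟨x, y⟩ : ℂ) ∈ C := by
  have : Convex ℝ {x : ℝ | (⟨x, y⟩ : ℂ) ∈ C} := by
    intro u hu v hv a b ha hb hab
    have h := hC hu hv ha hb hab
    rw [mem_ofPred_eq]
    convert h using 1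
    apply Complex.ext
    · simp
    · simp [← add_mul, hab]
  exact this.ordConnected.out h1 h2 hx

/-- The part of `J₁` in the first quadrant contains the rectangles below its points. -/
lemma mk_mem_J₁_of_le (hα : Admissible α κ) {p : ℂ} (hp : p ∈ J₁ α) {x y : ℝ} (hx0 : 0 ≤ x)
    (hx : x ≤ p.re) (hy0 : 0 ≤ y) (hy : y ≤ p.im) : (⟨x, y⟩ : ℂ) ∈ J₁ α := by
  have hC := convex_J₁ α
  have hpre : p.re ≤ 1 := (Complex.re_le_norm p).trans (norm_le_one_of_mem_J₁ hα hp)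
  -- The rectangle is filled from its sides: the base lies between 0 and 1, the left side between 0
  -- and the top point.
  have h1 : (⟨p.re, 0⟩ : ℂ) ∈ J₁ α :=
    hC.mk_mem_of_mem_Icc_re (zero_mem_J₁ α) (one_mem_J₁ α) ⟨hx0.trans hx, hpre⟩
  have h2 : (⟨p.re, y⟩ : ℂ) ∈ J₁ α := hC.mk_mem_of_mem_Icc_im h1 hp ⟨hy0, hy⟩
  have h3 : (⟨0, y⟩ : ℂ) ∈ J₁ α := hC.mk_mem_of_mem_Icc_im (zero_mem_J₁ α) (topPoint_mem hα)
    ⟨hy0, hy.trans (im_le_topHeight hα hp)⟩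
  exact hC.mk_mem_of_mem_Icc_re h3 h2 ⟨hx0, hx⟩

/-- The reflection of a point to the first quadrant. -/
def absPart (z : ℂ) : ℂ := ⟨|z.re|, |z.im|⟩

@[simp] lemma absPart_re (z : ℂ) : (absPart z).re = |z.re| := rfl
@[simp] lemma absPart_im (z : ℂ) : (absPart z).im = |z.im| := rfl

lemma continuous_absPart : Continuous absPart := by
  have : absPart = fun z => Complex.equivRealProdCLM.symm (|z.re|, |z.im|) := by
    ext z; simp [absPart, Complex.ext_iff]
  rw [this]; fun_prop

lemma absPart_of_nonneg {z : ℂ} (h1 : 0 ≤ z.re) (h2 : 0 ≤ z.im) : absPart z = z :=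
  Complex.ext (abs_of_nonneg h1) (abs_of_nonneg h2)

/-- The absolute coordinates of a convex combination are at most the combination of absolute
coordinates, and `J₁` allows nonnegative coordinates to be decreased. -/
lemma convex_absPart_preimage (hα : Admissible α κ) : Convex ℝ (absPart ⁻¹' J₁ α) := by
  intro z hz w hw a b ha hb hab
  refine mk_mem_J₁_of_le hα (convex_J₁ α hz hw ha hb hab) (abs_nonneg _) ?_ (abs_nonneg _) ?_
  · simp only [Complex.add_re, Complex.smul_re, smul_eq_mul, absPart_re]
    exact (abs_add_le _ _).trans_eq (by rw [abs_mul, abs_mul, abs_of_nonneg ha, abs_of_nonneg hb])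
  · simp only [Complex.add_im, Complex.smul_im, smul_eq_mul, absPart_im]
    exact (abs_add_le _ _).trans_eq (by rw [abs_mul, abs_mul, abs_of_nonneg ha, abs_of_nonneg hb])

lemma A_succ_re_nonneg (hα : Admissible α κ) (n : ℕ) : 0 ≤ (A α (n + 1)).re := by
  have h := hα.ang_anti.antitone (Nat.le_add_left 1 n)
  have h1 : ang α 1 = Real.pi / 2 := hα.one
  rw [A_eq_dir, dir_re]
  exact Real.cos_nonneg_of_neg_pi_div_two_le_of_le (by linarith [hα.ang_pos (n + 1), Real.pi_pos])
    (by linarith)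

/-- The arc at `A 1 = i` crosses the imaginary axis, so `J₁` leaves the first quadrant; the choice
of `A 0` makes this arc symmetric, with `S 1` and `T 1` exchanged. -/
lemma neg_conj_mem_arc_one (hα : Admissible α κ) {z : ℂ} (hz : z ∈ arc α 1) :
    -(starRingEnd ℂ) z ∈ arc α 1 := by
  have hT : -(starRingEnd ℂ) (T α 1) = S α 1 := by
    rw [S_succ_eq_arcC hα 0, T_succ_eq_arcC, nrm_zero hα]
    apply Complex.ext
    · simp only [Complex.neg_re, Complex.conj_re, Complex.add_re, Complex.smul_re, dir_re,
        smul_eq_mul, Real.cos_pi_sub, arcC_zero_re hα]; ring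
    · simp only [Complex.neg_im, Complex.conj_im, Complex.add_im, Complex.smul_im, dir_im,
        smul_eq_mul, Real.sin_pi_sub]; ring
  have hS : -(starRingEnd ℂ) (S α 1) = T α 1 := by rw [← hT]; simp
  have hA : -(starRingEnd ℂ) (A α 1) = A α 1 := by
    rw [A_eq_dir, ang, hα.one]
    apply Complex.ext <;> simp
  have hc : -(starRingEnd ℂ) (arcC α 0) = arcC α 0 := by
    apply Complex.ext <;> simp [arcC_zero_re hα]
  rw [show (1 : ℕ) = 0 + 1 from rfl, arc_succ_eq hα] at hz ⊢
  refine ⟨?_, ?_⟩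
  · have hconv : Convex ℝ {z | -(starRingEnd ℂ) z ∈
        convexHull ℝ {S α (0 + 1), A α (0 + 1), T α (0 + 1)}} := by
      intro u hu v hv a b ha hb hab
      have h := convex_convexHull ℝ {S α (0 + 1), A α (0 + 1), T α (0 + 1)} hu hv ha hb hab
      rw [mem_ofPred_eq]
      convert h using 1
      simp; ring
    refine convexHull_min ?_ hconv hz.1
    rintro x (rfl | rfl | rfl)
    · rw [mem_ofPred_eq, zero_add, hS]; exact subset_convexHull ℝ _ (by simp)
    · rw [mem_ofPred_eq, zero_add, hA]; exact subset_convexHull ℝ _ (by simp)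
    · rw [mem_ofPred_eq, zero_add, hT]; exact subset_convexHull ℝ _ (by simp)
  · have h := hz.2
    rw [← h, dist_eq_norm, dist_eq_norm]
    nth_rewrite 1 [← hc]
    rw [show -(starRingEnd ℂ) z - -(starRingEnd ℂ) (arcC α 0)
      = -(starRingEnd ℂ) (z - arcC α 0) by rw [map_sub]; ring, norm_neg, RCLike.norm_conj]

lemma J₁_subset_absPart_preimage (hα : Admissible α κ) : J₁ α ⊆ absPart ⁻¹' J₁ α := by
  have hself : ∀ z ∈ J₁ α, 0 ≤ z.re → absPart z ∈ J₁ α := fun z hz h => by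
    rwa [absPart_of_nonneg h (im_nonneg_of_mem_J₁ hα hz)]
  have hre : ∀ k, A α (k + 1) ∈ {z : ℂ | 0 ≤ z.re} := A_succ_re_nonneg hα
  refine convexHull_min ?_ (convex_absPart_preimage hα)
  intro w hw
  have hwJ : w ∈ J₁ α := subset_convexHull ℝ _ hw
  rcases hw with (hw | hw) | hw
  · refine hself w hwJ ?_
    rcases hw with rfl | rfl <;> simp
  · simp only [mem_iUnion] at hw
    obtain ⟨m, hm, hw⟩ := hw
    rcases le_total 0 w.re with h | h
    · exact hself w hwJ h
    · by_cases hm1 : m = 1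
      · subst hm1
        have h2 := arc_subset_J₁ α 0 (neg_conj_mem_arc_one hα hw)
        have h3 := hself _ h2 (by simpa using h)
        simpa [absPart] using h3
      · obtain ⟨m, rfl⟩ : ∃ k, m = k + 2 := ⟨m - 2, by omega⟩
        exact hself w hwJ (arc_subset_of_convex hα (convex_halfSpace_re_ge 0) (hre m)
          (hre (m + 1)) (hre (m + 2)) hw)
  · simp only [mem_iUnion] at hw
    obtain ⟨m, hm, hw⟩ := hw
    obtain ⟨m, rfl⟩ : ∃ k, m = k + 1 := ⟨m - 1, by omega⟩
    exact hself w hwJ (segment_subset_of_convex hα (convex_halfSpace_re_ge 0) (hre m)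
          (hre (m + 1)) hw)

/-- A single preimage replaces a union of reflected pieces whose convexity is not evident. -/
lemma K_eq (hα : Admissible α κ) : K α = absPart ⁻¹' J₁ α := by
  have hJ := J₁_subset_absPart_preimage hα
  have e1 : ∀ z, absPart ((starRingEnd ℂ) z) = absPart z := fun z => by simp [absPart]
  have e2 : ∀ z, absPart (-(starRingEnd ℂ) z) = absPart z := fun z => by simp [absPart]
  apply Subset.antisymm
  · rintro z ((hz | ⟨w, hw, rfl⟩) | ⟨w, hw | ⟨w, hw, rfl⟩, rfl⟩)
    · exact hJ hz
    · simpa only [mem_preimage, e1] using hJ hw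
    · simpa only [mem_preimage, e2] using hJ hw
    · simpa only [mem_preimage, e1, e2] using hJ hw
  · intro z hz
    rw [mem_preimage] at hz
    rcases le_total 0 z.re with h1 | h1 <;> rcases le_total 0 z.im with h2 | h2
    · left; left
      rwa [absPart_of_nonneg h1 h2] at hz
    · left; right
      refine ⟨absPart z, hz, Complex.ext ?_ ?_⟩ <;> simp [abs_of_nonneg, abs_of_nonpos, h1, h2]
    · right
      refine ⟨absPart z, Or.inl hz, Complex.ext ?_ ?_⟩ <;>
        simp [abs_of_nonneg, abs_of_nonpos, h1, h2]
    · right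
      refine ⟨(starRingEnd ℂ) (absPart z), Or.inr ⟨_, hz, rfl⟩, Complex.ext ?_ ?_⟩ <;>
        simp [abs_of_nonneg, abs_of_nonpos, h1, h2]

lemma J₁_subset_K (α : ℕ → ℝ) : J₁ α ⊆ K α := fun _ hz => Or.inl (Or.inl hz)

lemma convex_K (hα : Admissible α κ) : Convex ℝ (K α) := by
  rw [K_eq hα]; exact convex_absPart_preimage hα

lemma conj_mem_K (hα : Admissible α κ) {z : ℂ} (hz : z ∈ K α) : (starRingEnd ℂ) z ∈ K α := by
  rw [K_eq hα] at hz ⊢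
  simpa [absPart] using hz

lemma re_le_one_of_mem_K (hα : Admissible α κ) {z : ℂ} (hz : z ∈ K α) : z.re ≤ 1 := by
  rw [K_eq hα] at hz
  have h := (Complex.re_le_norm _).trans (norm_le_one_of_mem_J₁ hα hz)
  exact (le_abs_self _).trans h

/-- Half-planes that contain `J₁` and whose normal is in the first quadrant contain `K`. -/
lemma supp_le_of_mem_K (hα : Admissible α κ) {n : ℕ} {φ : ℝ}
    (hφ : φ ∈ Icc (nrm α (n + 1)) (nrm α n)) (hφ2 : φ ≤ Real.pi / 2) {z : ℂ} (hz : z ∈ K α) :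
    supp φ z ≤ supp φ (arcC α n + arcR α n • dir φ) := by
  rw [K_eq hα] at hz
  refine le_trans ?_ (supp_le_of_mem_J₁ hα hφ hφ2 hz)
  have h0 : 0 < φ := (hα.nrm_pos _).trans_le hφ.1
  have hc := Real.cos_nonneg_of_neg_pi_div_two_le_of_le (by linarith [Real.pi_pos]) hφ2
  have hs := Real.sin_nonneg_of_nonneg_of_le_pi h0.le (by linarith [Real.pi_pos])
  simp only [supp, absPart_re, absPart_im]
  exact add_le_add (mul_le_mul_of_nonneg_right (le_abs_self _) hc)
    (mul_le_mul_of_nonneg_right (le_abs_self _) hs)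

/-- The midpoint of 1 and the top point has positive coordinates; the rectangle below it reflects to
a neighbourhood of 0. -/
lemma zero_mem_interior_K (hα : Admissible α κ) : (0 : ℂ) ∈ interior (K α) := by
  have hpos := topHeight_pos hα
  rw [mem_interior_iff_mem_nhds]
  have hre : ∀ᶠ z : ℂ in 𝓝 0, |z.re| < 1 / 2 :=
    (Complex.continuous_re.abs.tendsto' 0 0 (by simp)).eventually (gt_mem_nhds (by norm_num))
  have him : ∀ᶠ z : ℂ in 𝓝 0, |z.im| < topHeight α / 2 :=
    (Complex.continuous_im.abs.tendsto' 0 0 (by simp)).eventually (gt_mem_nhds (by positivity))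
  have hmem : (⟨1 / 2, topHeight α / 2⟩ : ℂ) ∈ J₁ α := by
    have h := convex_J₁ α (one_mem_J₁ α) (topPoint_mem hα) (by norm_num : (0 : ℝ) ≤ 1 / 2)
      (by norm_num : (0 : ℝ) ≤ 1 / 2) (by norm_num)
    convert h using 1
    apply Complex.ext
    · simp
    · simp; ring
  filter_upwards [hre, him] with z h1 h2
  rw [K_eq hα]
  exact mk_mem_J₁_of_le hα hmem (abs_nonneg _) h1.le (abs_nonneg _) h2.le

/-! ### Closedness of `K`. -/

lemma tendsto_alpha (hα : Admissible α κ) : Tendsto α atTop (𝓝 0) := by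
  have hb : ∀ n, α (n + 1) ≤ κ ^ n * α 1 := by
    intro n
    induction n with
    | zero => simp
    | succ n ih =>
      calc α (n + 1 + 1) ≤ κ * α (n + 1) := hα.contract _ (by omega)
        _ ≤ κ * (κ ^ n * α 1) := mul_le_mul_of_nonneg_left ih hα.nonneg
        _ = κ ^ (n + 1) * α 1 := by ring
  rw [← tendsto_add_atTop_iff_nat 1]
  refine squeeze_zero (fun n => (hα.pos _ (by omega)).le) hb ?_
  simpa using (tendsto_pow_atTop_nhds_zero_of_lt_one hα.nonneg hα.lt_one).mul_const (α 1)

lemma tendsto_ang (hα : Admissible α κ) : Tendsto (ang α) atTop (𝓝 0) := by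
  rw [← tendsto_add_atTop_iff_nat 1]
  exact (tendsto_alpha hα).comp (tendsto_add_atTop_nat 1)

/-- By Carathéodory's theorem the hull is the image of a compact set, a finite power of `s` times a
simplex, under a continuous map. -/
lemma isCompact_convexHull {E : Type*} [NormedAddCommGroup E] [NormedSpace ℝ E]
    [FiniteDimensional ℝ E] {s : Set E} (hs : IsCompact s) : IsCompact (convexHull ℝ s) := by
  rcases s.eq_empty_or_nonempty with rfl | ⟨s₀, hs₀⟩
  · simp
  set d := Module.finrank ℝ E + 1
  have hc : IsCompact ((univ.pi fun _ : Fin d => s) ×ˢ stdSimplex ℝ (Fin d)) :=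
    (isCompact_univ_pi fun _ => hs).prod (isCompact_stdSimplex ℝ (Fin d))
  have hf : Continuous fun p : (Fin d → E) × (Fin d → ℝ) => ∑ i, p.2 i • p.1 i := by fun_prop
  convert hc.image hf using 1
  apply Subset.antisymm
  · intro x hx
    obtain ⟨ι, _, z, w, hz, hai, hw, hw1, rfl⟩ := eq_pos_convex_span_of_mem_convexHull hx
    obtain ⟨f⟩ : Nonempty (ι ↪ Fin d) := Function.Embedding.nonempty_of_card_le (by
      rw [Fintype.card_fin]
      exact hai.card_le_finrank_succ.trans (Nat.succ_le_succ (Submodule.finrank_le _)))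
    -- Unused indices are padded with the point `s₀` and weight 0.
    refine ⟨(Function.extend f z fun _ => s₀, Function.extend f w 0), ⟨?_, ?_, ?_⟩, ?_⟩
    · intro j _
      by_cases hj : ∃ i, f i = j
      · obtain ⟨i, rfl⟩ := hj
        simpa only [f.injective.extend_apply] using hz (mem_range_self i)
      · simpa only [Function.extend_apply' _ _ _ hj] using hs₀
    · intro j
      by_cases hj : ∃ i, f i = j
      · obtain ⟨i, rfl⟩ := hj
        simpa only [f.injective.extend_apply] using (hw i).le
      · simp [Function.extend_apply' _ _ _ hj]
    · rw [← hw1]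
      refine (Fintype.sum_of_injective f f.injective _ _ ?_ ?_).symm
      · intro j hj
        exact Function.extend_apply' _ _ _ hj
      · intro i
        simp [f.injective.extend_apply]
    · refine (Fintype.sum_of_injective f f.injective _ _ ?_ ?_).symm
      · intro j hj
        simp [Function.extend_apply' _ _ _ (show ¬∃ a, f a = j from hj)]
      · intro i
        simp [f.injective.extend_apply]
  · rintro _ ⟨p, ⟨hp, hw⟩, rfl⟩
    exact (convex_convexHull ℝ s).sum_mem (fun i _ => hw.1 i) hw.2
      fun i _ => subset_convexHull ℝ s (hp i (mem_univ i))

/-- An ultrafilter on the union either contains one compact piece, or avoids every finite number of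
pieces and so converges to `x`. -/
lemma isCompact_insert_iUnion {X : Type*} [PseudoMetricSpace X] {P : ℕ → Set X} {x : X}
    {ε : ℕ → ℝ} (hP : ∀ n, IsCompact (P n)) (hε : Tendsto ε atTop (𝓝 0))
    (hsub : ∀ n, P n ⊆ Metric.closedBall x (ε n)) : IsCompact (insert x (⋃ n, P n)) := by
  rw [isCompact_iff_ultrafilter_le_nhds]
  intro f hf
  by_cases h : ∃ n, P n ∈ f
  · obtain ⟨n, hn⟩ := h
    obtain ⟨y, hy, hfy⟩ := isCompact_iff_ultrafilter_le_nhds.1 (hP n) f (le_principal_iff.2 hn)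
    exact ⟨y, Or.inr (mem_iUnion.2 ⟨n, hy⟩), hfy⟩
  · push Not at h
    refine ⟨x, Or.inl rfl, ?_⟩
    rw [Metric.nhds_basis_ball.ge_iff]
    intro r hr
    obtain ⟨N, hN⟩ := eventually_atTop.1 (hε.eventually (gt_mem_nhds hr))
    have h1 : (⋂ n ∈ Finset.range N, (P n)ᶜ) ∈ f :=
      (biInter_finset_mem _).2 fun n _ => Ultrafilter.compl_mem_iff_notMem.2 (h n)
    filter_upwards [h1, le_principal_iff.1 hf] with y hy1 hy2
    rcases hy2 with rfl | hy2
    · exact Metric.mem_ball_self hr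
    · obtain ⟨n, hn⟩ := mem_iUnion.1 hy2
      have hNn : N ≤ n := by
        by_contra hlt
        exact mem_iInter₂.1 hy1 n (Finset.mem_range.2 (not_le.1 hlt)) hn
      exact Metric.closedBall_subset_ball (hN n hNn) (hsub n hn)

lemma A_mem_closedBall (hα : Admissible α κ) {k n : ℕ} (h : n ≤ k) :
    A α k ∈ Metric.closedBall 1 (ang α n) := by
  rw [A_eq_dir, mem_closedBall_iff_norm, ← exp_eq_dir, mul_comm]
  refine (Real.norm_exp_I_mul_ofReal_sub_one_le).trans ?_
  rw [Real.norm_eq_abs, abs_of_pos (hα.ang_pos k)]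
  exact hα.ang_anti.antitone h

lemma isCompact_arc_succ (hα : Admissible α κ) (n : ℕ) : IsCompact (arc α (n + 1)) := by
  rw [arc_succ_eq hα]
  exact ((toFinite _).isCompact_convexHull ℝ).inter_right Metric.isClosed_sphere

/-- The generating pieces shrink to the point 1, which is itself a generator. -/
lemma isCompact_J₁ (hα : Admissible α κ) : IsCompact (J₁ α) := by
  have h := (isCompact_insert_iUnion
    (P := fun n => arc α (n + 1) ∪ segment ℝ (T α (n + 1)) (S α (n + 2)))
    (fun n => (isCompact_arc_succ hα n).union (by
      rw [← convexHull_pair]; exact (toFinite _).isCompact_convexHull ℝ)) (tendsto_ang hα)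
    (x := 1) (fun n => union_subset
      (arc_subset_of_convex hα (convex_closedBall _ _) (A_mem_closedBall hα (by omega))
        (A_mem_closedBall hα (by omega)) (A_mem_closedBall hα (by omega)))
      (segment_subset_of_convex hα (convex_closedBall _ _) (A_mem_closedBall hα (by omega))
        (A_mem_closedBall hα (by omega))))).insert 0
  rw [J₁]
  convert isCompact_convexHull h using 2
  ext z
  have key : ∀ p : ℕ → Prop, (∃ n, n ≥ 1 ∧ p n) ↔ ∃ n, p (n + 1) := fun p =>
    ⟨fun ⟨n, hn, h⟩ => ⟨n - 1, by rwa [Nat.sub_add_cancel hn]⟩, fun ⟨n, h⟩ => ⟨n + 1, by omega, h⟩⟩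
  simp only [mem_union, mem_insert_iff, mem_singleton_iff, mem_iUnion, exists_prop, key,
    exists_or, or_assoc]

lemma isClosed_K (hα : Admissible α κ) : IsClosed (K α) := by
  rw [K_eq hα]; exact (isCompact_J₁ hα).isClosed.preimage continuous_absPart

/-! ### Boundary graphs from outer normals. -/

/-- `dir φ` is an outer normal of `Ω` at its point `p`. -/
def IsSupportedAt (Ω : Set ℂ) (p : ℂ) (φ : ℝ) : Prop :=
  p ∈ Ω ∧ ∀ z ∈ Ω, supp φ z ≤ supp φ p

lemma IsSupportedAt.mem_frontier {Ω : Set ℂ} {p : ℂ} {φ : ℝ} (h : IsSupportedAt Ω p φ) :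
    p ∈ frontier Ω := by
  refine ⟨subset_closure h.1, fun hi => ?_⟩
  obtain ⟨ε, hε, hb⟩ := Metric.isOpen_iff.1 isOpen_interior p hi
  have hmem : p + (ε / 2) • dir φ ∈ Metric.ball p ε := by
    rw [mem_ball_iff_norm, add_sub_cancel_left, norm_smul, norm_dir, Real.norm_eq_abs,
      abs_of_pos (by positivity)]
    linarith
  have := h.2 _ (interior_subset (hb hmem))
  rw [supp_add, supp_smul, supp_dir_self] at this
  linarith

lemma IsSupportedAt.conj {Ω : Set ℂ} (hΩ : ∀ z ∈ Ω, (starRingEnd ℂ) z ∈ Ω) {p : ℂ} {φ : ℝ}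
    (h : IsSupportedAt Ω p φ) : IsSupportedAt Ω ((starRingEnd ℂ) p) (-φ) := by
  refine ⟨hΩ p h.1, fun z hz => ?_⟩
  have := h.2 _ (hΩ z hz)
  simpa [supp] using this

/-- A supporting half-plane bounds the abscissae by an affine function of the ordinates. -/
lemma IsSupportedAt.re_le {Ω : Set ℂ} {p z : ℂ} {φ : ℝ} (h : IsSupportedAt Ω p φ)
    (hφ : 0 < Real.cos φ) (hz : z ∈ Ω) : z.re ≤ p.re - Real.tan φ * (z.im - p.im) := by
  have h1 := h.2 z hz
  simp only [supp] at h1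
  rw [Real.tan_eq_sin_div_cos, div_mul_eq_mul_div, le_sub_iff_add_le, ← le_sub_iff_add_le',
    div_le_iff₀ hφ]
  linarith

/-- The inequality from `y` to `v` and the one from `v` to `y` squeeze `g v - g y` between `m v * (v
- y)` and `m y * (v - y)`. -/
lemma hasDerivAt_of_continuousAt_supergradient {g m : ℝ → ℝ} {y : ℝ} {s : Set ℝ} (hs : s ∈ 𝓝 y)
    (h : ∀ u ∈ s, ∀ v ∈ s, g v ≤ g u + m u * (v - u)) (hm : ContinuousAt m y) :
    HasDerivAt g (m y) y := by
  have hy := mem_of_mem_nhds hs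
  rw [hasDerivAt_iff_isLittleO, Asymptotics.isLittleO_iff]
  intro c hc
  have h1 : ∀ᶠ v in 𝓝 y, |m v - m y| < c := by
    have := (Metric.continuousAt_iff'.1 hm) c hc
    simpa only [Real.dist_eq] using this
  filter_upwards [h1, hs] with v hv hvs
  have e1 := h y hy v hvs
  have e2 := h v hvs y hy
  simp only [Real.norm_eq_abs, smul_eq_mul]
  calc |g v - g y - (v - y) * m y| ≤ |(m v - m y) * (v - y)| := by
        rw [abs_of_nonpos (by linarith : g v - g y - (v - y) * m y ≤ 0)]
        refine le_trans ?_ (neg_le_abs _)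
        linarith
    _ = |m v - m y| * |v - y| := abs_mul _ _
    _ ≤ c * |v - y| := by gcongr

/-- A closed convex set whose boundary points near the real axis have outer normals depending
continuously on the ordinate is bounded by a continuously differentiable graph; the derivative is
Lipschitz if the normals depend on the ordinate in a Lipschitz way. -/
lemma exists_boundaryGraph {Ω : Set ℂ} (hcl : IsClosed Ω) (hconv : Convex ℝ Ω)
    (h0 : (0 : ℂ) ∈ interior Ω) {p : ℂ} (hp : p ∈ frontier Ω) (hpim : p.im = 0) (hpre : 0 < p.re)
    {b : ℝ} (hb : 0 < b) {ψ : ℝ → ℝ} (hψ : ContinuousOn ψ (Icc (-b) b))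
    (hψ2 : ∀ y ∈ Icc (-b) b, |ψ y| < Real.pi / 2)
    (hsup : ∀ y ∈ Icc (-b) b, ∃ x : ℝ, IsSupportedAt Ω ⟨x, y⟩ (ψ y)) :
    ∃ g : ℝ → ℝ, IsBoundaryGraph Ω p g ∧ ContDiffAt ℝ 1 g p.im ∧
      ((∃ s ∈ 𝓝 (0 : ℝ), ∃ L, LipschitzOnWith L ψ s) →
        ∃ s ∈ 𝓝 p.im, ∃ L, LipschitzOnWith L (deriv g) s) := by
  choose! g hg using hsup
  have hcos : ∀ y ∈ Icc (-b) b, 0 < Real.cos (ψ y) := fun y hy =>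
    Real.cos_pos_of_mem_Ioo (abs_lt.1 (hψ2 y hy))
  have hle : ∀ y ∈ Icc (-b) b, ∀ z ∈ Ω, z.re ≤ g y - Real.tan (ψ y) * (z.im - y) :=
    fun y hy z hz => (hg y hy).re_le (hcos y hy) hz
  have hm : ContinuousOn (fun y => -Real.tan (ψ y)) (Icc (-b) b) := fun y hy =>
    ((Real.continuousAt_tan.2 (hcos y hy).ne').comp_continuousWithinAt (hψ y hy)).neg
  have hder : ∀ y ∈ Ioo (-b) b, HasDerivAt g (-Real.tan (ψ y)) y := by
    intro y hy
    have hnhds : Icc (-b) b ∈ 𝓝 y := Icc_mem_nhds hy.1 hy.2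
    refine hasDerivAt_of_continuousAt_supergradient (m := fun y => -Real.tan (ψ y)) hnhds ?_
      (hm.continuousAt hnhds)
    intro u hu v hv
    have := hle u hu _ (hg v hv).1
    simp only at this
    linarith
  have hIoo : Ioo (-b) b ∈ 𝓝 (0 : ℝ) := Ioo_mem_nhds (by linarith) hb
  have hderiv : ∀ y ∈ Ioo (-b) b, deriv g y = -Real.tan (ψ y) := fun y hy => (hder y hy).deriv
  refine ⟨g, ⟨hp, ?_⟩, ?_, ?_⟩
  · have e1 : ∀ᶠ z : ℂ in 𝓝 p, z.im ∈ Ioo (-b) b :=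
      Complex.continuous_im.continuousAt.eventually (by rw [hpim]; exact hIoo)
    have e2 : ∀ᶠ z : ℂ in 𝓝 p, 0 < z.re :=
      Complex.continuous_re.continuousAt.eventually (lt_mem_nhds hpre)
    have e3 : ∀ᶠ z : ℂ in 𝓝 p, ((z.im : ℂ) * Complex.I) ∈ interior Ω := by
      have hc : Continuous fun z : ℂ => (z.im : ℂ) * Complex.I := by fun_prop
      refine hc.continuousAt.eventually (isOpen_interior.mem_nhds ?_)
      simpa [hpim] using h0
    filter_upwards [e1, e2, e3] with z h1 h2 h3
    have h1' := Ioo_subset_Icc_self h1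
    constructor
    · intro hz
      have hzΩ : z ∈ Ω := hcl.frontier_subset hz
      have hzle := hle z.im h1' z hzΩ
      rw [sub_self, mul_zero, sub_zero] at hzle
      by_contra hne
      have hlt : z.re < g z.im := lt_of_le_of_ne hzle hne
      have hgpos : 0 < g z.im := h2.trans hlt
      -- Here `z` lies strictly between the interior point at height `z.im` on the imaginary axis
      -- and the boundary point at that height, so it would be interior.
      refine hz.2 (hconv.openSegment_interior_self_subset_interior h3 (hg z.im h1').1 ?_)
      refine ⟨1 - z.re / g z.im, z.re / g z.im, ?_, by positivity, by ring, ?_⟩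
      · rw [sub_pos, div_lt_one hgpos]; exact hlt
      · apply Complex.ext
        · simp
          field_simp
        · simp
          ring
    · intro hz
      have : z = ⟨g z.im, z.im⟩ := Complex.ext hz rfl
      rw [this]
      exact (hg z.im h1').mem_frontier
  · rw [hpim]
    have hc : ContDiffOn ℝ 1 g (Ioo (-b) b) := by
      rw [show (1 : WithTop ℕ∞) = 0 + 1 by rfl, contDiffOn_succ_iff_deriv_of_isOpen isOpen_Ioo]
      refine ⟨fun y hy => (hder y hy).differentiableAt.differentiableWithinAt, by simp, ?_⟩
      rw [contDiffOn_zero]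
      exact (hm.mono Ioo_subset_Icc_self).congr hderiv
    exact hc.contDiffAt hIoo
  · rintro ⟨s, hs, L, hL⟩
    have h0mem : (0 : ℝ) ∈ Icc (-b) b := ⟨by linarith, hb.le⟩
    obtain ⟨M, t, ht, hM⟩ := ((Real.contDiffAt_tan (n := 1)).2
      (hcos 0 h0mem).ne').exists_lipschitzOnWith
    have hψ0 : ContinuousAt ψ 0 := hψ.continuousAt (Icc_mem_nhds (by linarith) hb)
    refine ⟨Ioo (-b) b ∩ (s ∩ ψ ⁻¹' t), ?_, M * L, ?_⟩
    · rw [hpim]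
      exact inter_mem hIoo (inter_mem hs (hψ0 ht))
    · have hcomp : LipschitzOnWith (M * L) (fun y => Real.tan (ψ y)) (Ioo (-b) b ∩ (s ∩ ψ ⁻¹' t)) :=
        (hM.mono subset_rfl).comp (hL.mono fun y hy => hy.2.1) fun y hy => hy.2.2
      refine LipschitzOnWith.of_dist_le_mul fun u hu v hv => ?_
      rw [hderiv u hu.1, hderiv v hv.1, dist_neg_neg]
      exact hcomp.dist_le_mul u hu v hv

/-! ### Gluing infinitely many monotone pieces. -/

section Glue

variable {b L : ℕ → ℝ} {q : ℕ → ℝ → ℝ}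

/-- `f` is nondecreasing on `[a, c]`, with slopes at most `M`. -/
def SlopesIn (f : ℝ → ℝ) (M a c : ℝ) : Prop :=
  ∀ y ∈ Icc a c, ∀ y' ∈ Icc a c, y ≤ y' → 0 ≤ f y' - f y ∧ f y' - f y ≤ M * (y' - y)

lemma SlopesIn.trans {f : ℝ → ℝ} {M a c d : ℝ} (hac : a ≤ c) (hcd : c ≤ d)
    (h1 : SlopesIn f M a c) (h2 : SlopesIn f M c d) : SlopesIn f M a d := by
  intro y hy y' hy' hyy
  rcases le_total y' c with h | h
  · exact h1 y ⟨hy.1, hyy.trans h⟩ y' ⟨hy'.1, h⟩ hyy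
  rcases le_total c y with h' | h'
  · exact h2 y ⟨h', hy.2⟩ y' ⟨h, hy'.2⟩ hyy
  · have e1 := h1 y ⟨hy.1, h'⟩ c ⟨hac, le_rfl⟩ h'
    have e2 := h2 c ⟨le_rfl, hcd⟩ y' ⟨h, hy'.2⟩ h
    exact ⟨by linarith [e1.1, e2.1], by linarith [e1.2, e2.2]⟩

lemma exists_piecewise (hb : StrictAnti b) (hq : ∀ n, q n (b (n + 1)) = q (n + 1) (b (n + 1))) :
    ∃ f : ℝ → ℝ, ∀ n, ∀ y ∈ Icc (b (n + 1)) (b n), f y = q n y := by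
  -- The least admissible index; at a common endpoint of two pieces this is the smaller one, and
  -- `hq` makes the choice harmless.
  refine ⟨fun y => q (sInf {n | b (n + 1) ≤ y}) y, fun n y hy => ?_⟩
  have hn : n ∈ {n | b (n + 1) ≤ y} := hy.1
  set N := sInf {n | b (n + 1) ≤ y}
  have hN : b (N + 1) ≤ y := Nat.sInf_mem ⟨n, hn⟩
  have hNn : N ≤ n := Nat.sInf_le hn
  rcases hNn.eq_or_lt with h | h
  · change q N y = q n y
    rw [h]
  · have h1 : n ≤ N + 1 := by
      by_contra hlt
      push Not at hlt
      linarith [hb hlt, hy.2]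
    obtain rfl : n = N + 1 := le_antisymm h1 h
    have h2 : y = b (N + 1) := le_antisymm hy.2 hN
    change q N y = q (N + 1) y
    rw [h2, hq]

lemma slopesIn_of_piecewise (hb : StrictAnti b) {f : ℝ → ℝ}
    (hf : ∀ n, ∀ y ∈ Icc (b (n + 1)) (b n), f y = q n y)
    (hqL : ∀ n, SlopesIn (q n) (L n) (b (n + 1)) (b n)) {M : ℝ} {n : ℕ} (hM : ∀ k < n, L k ≤ M) :
    SlopesIn f M (b n) (b 0) := by
  induction n with
  | zero =>
    intro y hy y' hy' _
    rw [le_antisymm hy.2 hy.1, le_antisymm hy'.2 hy'.1]; simp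
  | succ n ih =>
    refine SlopesIn.trans (hb.antitone (Nat.le_succ n)) (hb.antitone (Nat.zero_le n)) ?_
      (ih fun k hk => hM k (by omega))
    intro y hy y' hy' hyy
    rw [hf n y hy, hf n y' hy']
    have := hqL n y hy y' hy' hyy
    exact ⟨this.1, this.2.trans (mul_le_mul_of_nonneg_right (hM n (by omega)) (by linarith))⟩

/-- Infinitely many monotone pieces that accumulate at the origin are glued to a continuous
function, which is Lipschitz if the pieces are uniformly so. -/
lemma exists_glue (hb : StrictAnti b) (hb0 : Tendsto b atTop (𝓝 0))
    (hq : ∀ n, q n (b (n + 1)) = q (n + 1) (b (n + 1)))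
    (hqL : ∀ n, SlopesIn (q n) (L n) (b (n + 1)) (b n))
    (hq0 : Tendsto (fun n => q n (b n)) atTop (𝓝 0)) :
    ∃ f : ℝ → ℝ, f 0 = 0 ∧ (∀ n, ∀ y ∈ Icc (b (n + 1)) (b n), f y = q n y) ∧
      ContinuousOn f (Icc 0 (b 0)) ∧
      ∀ M, (∀ n, L n ≤ M) → SlopesIn f M 0 (b 0) := by
  have hbpos : ∀ n, 0 < b n := fun n =>
    (hb.antitone.le_of_tendsto hb0 (n + 1)).trans_lt (hb (Nat.lt_succ_self n))
  obtain ⟨f₀, hf₀⟩ := exists_piecewise hb hq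
  set f : ℝ → ℝ := fun y => if y ≤ 0 then 0 else f₀ y with hfdef
  have hfz : f 0 = 0 := by simp [hfdef]
  have hf : ∀ n, ∀ y ∈ Icc (b (n + 1)) (b n), f y = q n y := fun n y hy => by
    rw [← hf₀ n y hy, hfdef]
    exact if_neg (not_le.2 ((hbpos _).trans_le hy.1))
  have hfb : ∀ n, f (b n) = q n (b n) := fun n =>
    hf n _ ⟨hb.antitone (Nat.le_succ n), le_rfl⟩
  have hfb0 : Tendsto (fun n => f (b n)) atTop (𝓝 0) := by simpa only [hfb] using hq0
  -- Above `b n` only finitely many pieces occur, so continuity away from 0 needs no uniform bound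
  -- on `L`.
  have hslope : ∀ n, ∃ M, 0 ≤ M ∧ SlopesIn f M (b n) (b 0) := fun n =>
    ⟨∑ k ∈ Finset.range n, |L k|, Finset.sum_nonneg fun k _ => abs_nonneg _,
      slopesIn_of_piecewise hb hf hqL fun k hk => (le_abs_self _).trans
        (Finset.single_le_sum (f := fun k => |L k|) (fun i _ => abs_nonneg _)
          (Finset.mem_range.2 hk))⟩
  have hbelow : ∀ y > 0, ∃ n, b n < y := fun y hy =>
    (hb0.eventually (gt_mem_nhds hy)).exists
  have hmono : ∀ y ∈ Ioc 0 (b 0), ∀ y' ∈ Ioc 0 (b 0), y ≤ y' → f y ≤ f y' := by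
    intro y hy y' hy' hyy
    obtain ⟨n, hn⟩ := hbelow y hy.1
    obtain ⟨M, -, hM⟩ := hslope n
    linarith [(hM y ⟨hn.le, hy.2⟩ y' ⟨hn.le.trans hyy, hy'.2⟩ hyy).1]
  have hbI : ∀ n, b n ∈ Ioc 0 (b 0) := fun n => ⟨hbpos n, hb.antitone (Nat.zero_le n)⟩
  have hnonneg : ∀ y ∈ Icc 0 (b 0), 0 ≤ f y := by
    intro y hy
    rcases hy.1.eq_or_lt with rfl | h
    · rw [hfz]
    · refine le_of_tendsto hfb0 ?_
      filter_upwards [hb0.eventually (gt_mem_nhds h)] with n hn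
      exact hmono _ (hbI n) _ ⟨h, hy.2⟩ hn.le
  refine ⟨f, hfz, hf, ?_, ?_⟩
  · intro y hy
    rcases hy.1.eq_or_lt with rfl | h
    · rw [Metric.continuousWithinAt_iff']
      intro ε hε
      obtain ⟨n, hn⟩ := (hfb0.eventually (gt_mem_nhds hε)).exists
      have h1 : ∀ᶠ u in 𝓝[Icc 0 (b 0)] (0 : ℝ), u < b n :=
        nhdsWithin_le_nhds (gt_mem_nhds (hbpos n))
      filter_upwards [h1, self_mem_nhdsWithin] with u hu hu2
      rw [hfz, Real.dist_eq, sub_zero, abs_of_nonneg (hnonneg u hu2)]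
      rcases hu2.1.eq_or_lt with rfl | h
      · rwa [hfz]
      · exact (hmono u ⟨h, hu2.2⟩ _ (hbI n) hu.le).trans_lt hn
    · obtain ⟨n, hn⟩ := hbelow y h
      obtain ⟨M, hM0, hM⟩ := hslope n
      have hlip : LipschitzOnWith M.toNNReal f (Icc (b n) (b 0)) := by
        refine LipschitzOnWith.of_dist_le_mul fun u hu v hv => ?_
        rw [Real.coe_toNNReal _ hM0, Real.dist_eq, Real.dist_eq]
        rcases le_total u v with huv | huv
        · have := hM u hu v hv huv
          rw [abs_sub_comm, abs_of_nonneg this.1, abs_sub_comm, abs_of_nonneg (by linarith)]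
          exact this.2
        · have := hM v hv u hu huv
          rw [abs_of_nonneg this.1, abs_of_nonneg (by linarith)]
          exact this.2
      refine (hlip.continuousOn y ⟨hn.le, hy.2⟩).mono_of_mem_nhdsWithin ?_
      filter_upwards [self_mem_nhdsWithin, nhdsWithin_le_nhds (lt_mem_nhds hn)] with u hu hu2
      exact ⟨hu2.le, hu.2⟩
  · intro M hM y hy y' hy' hyy
    rcases hy.1.eq_or_lt with rfl | h
    · rw [hfz, sub_zero, sub_zero]
      refine ⟨hnonneg y' hy', ?_⟩
      rcases hy'.1.eq_or_lt with rfl | h'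
      · rw [hfz, mul_zero]
      · have ht : Tendsto (fun n => f (b n) + M * (y' - b n)) atTop (𝓝 (0 + M * (y' - 0))) :=
          hfb0.add ((tendsto_const_nhds.sub hb0).const_mul M)
        have : f y' ≤ 0 + M * (y' - 0) := by
          refine ge_of_tendsto ht ?_
          filter_upwards [hb0.eventually (gt_mem_nhds h')] with n hn
          have := slopesIn_of_piecewise hb hf hqL (fun k (_ : k < n) => hM k) (b n)
            ⟨le_rfl, (hbI n).2⟩ y' ⟨hn.le, hy'.2⟩ hn.le
          linarith [this.2]
        simpa using this
    · obtain ⟨n, hn⟩ := hbelow y h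
      exact slopesIn_of_piecewise hb hf hqL (fun k (_ : k < n) => hM k) y ⟨hn.le, hy.2⟩ y'
        ⟨hn.le.trans hyy, hy'.2⟩ hyy

end Glue

/-! ### The normal angle of the boundary of `K` near 1. -/

lemma supp_perp (φ : ℝ) : supp φ ⟨-Real.sin φ, Real.cos φ⟩ = 0 := by
  simp only [supp]; ring

lemma isSupportedAt_arc (hα : Admissible α κ) {n : ℕ} {φ : ℝ}
    (hφ : φ ∈ Icc (nrm α (n + 1)) (nrm α n)) (hφ2 : φ ≤ Real.pi / 2) :
    IsSupportedAt (K α) (arcC α n + arcR α n • dir φ) φ :=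
  ⟨J₁_subset_K α (arc_subset_J₁ α n (mem_arc_succ hα hφ)),
    fun _ hz => supp_le_of_mem_K hα hφ hφ2 hz⟩

lemma isSupportedAt_T (hα : Admissible α κ) (n : ℕ) :
    IsSupportedAt (K α) (T α (n + 1)) (nrm α (n + 1)) := by
  rw [T_succ_eq_arcC]
  exact isSupportedAt_arc hα ⟨le_rfl, hα.nrm_anti.antitone (Nat.le_succ n)⟩
    (hα.nrm_succ_lt n).le

lemma isSupportedAt_segment (hα : Admissible α κ) {n : ℕ} {s : ℝ} (hs0 : 0 ≤ s)
    (hs : s ≤ Real.sin (hgap α (n + 1)) - Real.sin (hgap α (n + 2))) :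
    IsSupportedAt (K α) (T α (n + 1) -
      s • (⟨-Real.sin (nrm α (n + 1)), Real.cos (nrm α (n + 1))⟩ : ℂ)) (nrm α (n + 1)) := by
  refine ⟨?_, fun z hz => ?_⟩
  · refine J₁_subset_K α (segment_subset_J₁ α n ?_)
    have hS := S_succ_eq_T_sub hα (n + 1)
    set τ := Real.sin (hgap α (n + 1)) - Real.sin (hgap α (n + 2))
    rcases (hs0.trans hs).eq_or_lt with h | h
    · obtain rfl : s = 0 := le_antisymm (by rw [h]; exact hs) hs0
      rw [zero_smul, sub_zero]
      exact left_mem_segment ℝ _ _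
    · refine ⟨1 - s / τ, s / τ, ?_, by positivity, by ring, ?_⟩
      · rw [sub_nonneg, div_le_one h]; exact hs
      · rw [hS, smul_sub, smul_smul, div_mul_cancel₀ _ h.ne']
        module
  · have h := (isSupportedAt_T hα n).2 z hz
    rwa [sub_eq_add_neg, ← neg_smul, supp_add, supp_smul, supp_perp, mul_zero, add_zero]

lemma isSupportedAt_S (hα : Admissible α κ) (n : ℕ) :
    IsSupportedAt (K α) (S α (n + 2)) (nrm α (n + 1)) := by
  rw [S_succ_eq_T_sub hα (n + 1)]
  exact isSupportedAt_segment hα (sub_nonneg.2 (hα.sin_hgap_succ_le (n + 1))) le_rfl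

lemma isSupportedAt_one (hα : Admissible α κ) : IsSupportedAt (K α) 1 0 :=
  ⟨J₁_subset_K α (one_mem_J₁ α), fun z hz => by simpa [supp] using re_le_one_of_mem_K hα hz⟩

lemma cos_nrm_succ_pos (hα : Admissible α κ) (n : ℕ) : 0 < Real.cos (nrm α (n + 1)) :=
  Real.cos_pos_of_mem_Ioo ⟨by linarith [hα.nrm_pos (n + 1), Real.pi_pos], hα.nrm_succ_lt n⟩

lemma sin_nrm_succ_pos (hα : Admissible α κ) (n : ℕ) : 0 < Real.sin (nrm α (n + 1)) :=
  Real.sin_pos_of_pos_of_lt_pi (hα.nrm_pos _) (by linarith [hα.nrm_succ_lt n, Real.pi_pos])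

lemma sin_nrm_lt (hα : Admissible α κ) (n : ℕ) :
    Real.sin (nrm α (n + 2)) < Real.sin (nrm α (n + 1)) :=
  Real.sin_lt_sin_of_lt_of_le_pi_div_two (by linarith [hα.nrm_pos (n + 2), Real.pi_pos])
    (hα.nrm_succ_lt n).le (hα.nrm_anti (Nat.lt_succ_self _))

lemma T_im_eq_arcC (α : ℕ → ℝ) (n : ℕ) :
    (T α (n + 1)).im = (arcC α n).im + arcR α n * Real.sin (nrm α (n + 1)) := by
  rw [T_succ_eq_arcC]; simp

lemma S_im_eq_arcC (hα : Admissible α κ) (n : ℕ) :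
    (S α (n + 1)).im = (arcC α n).im + arcR α n * Real.sin (nrm α n) := by
  rw [S_succ_eq_arcC hα]; simp

lemma T_im_lt_S_im (hα : Admissible α κ) (n : ℕ) : (T α (n + 2)).im < (S α (n + 2)).im := by
  rw [T_im_eq_arcC, S_im_eq_arcC hα]
  have := mul_lt_mul_of_pos_left (sin_nrm_lt hα n) (arcR_pos hα (n + 1))
  linarith

lemma S_im_le_T_im (hα : Admissible α κ) (n : ℕ) : (S α (n + 2)).im ≤ (T α (n + 1)).im := by
  rw [S_succ_eq_T_sub hα (n + 1)]
  simp only [Complex.sub_im, Complex.smul_im, smul_eq_mul]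
  have := mul_nonneg (sub_nonneg.2 (hα.sin_hgap_succ_le (n + 1))) (cos_nrm_succ_pos hα n).le
  linarith

lemma tendsto_S (hα : Admissible α κ) : Tendsto (fun n => S α (n + 1)) atTop (𝓝 1) := by
  rw [tendsto_iff_dist_tendsto_zero]
  exact squeeze_zero (fun _ => dist_nonneg) (fun n => Metric.mem_closedBall.1
    (S_mem_of_convex hα (convex_closedBall _ _) (A_mem_closedBall hα le_rfl)
      (A_mem_closedBall hα (Nat.le_succ n)))) (tendsto_ang hα)

lemma tendsto_T (hα : Admissible α κ) : Tendsto (fun n => T α n) atTop (𝓝 1) := by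
  rw [tendsto_iff_dist_tendsto_zero]
  exact squeeze_zero (fun _ => dist_nonneg) (fun n => Metric.mem_closedBall.1
    (T_mem_of_convex (convex_closedBall _ _) (A_mem_closedBall hα le_rfl)
      (A_mem_closedBall hα (Nat.le_succ n)))) (tendsto_ang hα)

lemma tendsto_nrm (hα : Admissible α κ) : Tendsto (nrm α) atTop (𝓝 0) := by
  have h := ((tendsto_ang hα).add ((tendsto_ang hα).comp (tendsto_add_atTop_nat 1))).div_const 2
  rw [add_zero, zero_div] at h
  exact h

lemma tendsto_hgap (hα : Admissible α κ) : Tendsto (hgap α) atTop (𝓝 0) := by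
  have h := ((tendsto_ang hα).sub ((tendsto_ang hα).comp (tendsto_add_atTop_nat 1))).div_const 2
  rw [sub_zero, zero_div] at h
  exact h

/-- The sine of the normal angle, as a function of the ordinate, on the segment from `T (n + 2)` to
`S (n + 3)` and the arc from `S (n + 2)` to `T (n + 2)`. -/
noncomputable def sinePiece (α : ℕ → ℝ) (n : ℕ) (y : ℝ) : ℝ :=
  -- On the arc the ordinate is affine in the sine of the normal angle, with slope the radius. This
  -- is why the sine is glued and not the angle.
  Real.sin (nrm α (n + 2)) + max 0 ((y - (T α (n + 2)).im) / arcR α (n + 1))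

lemma sinePiece_of_le (hα : Admissible α κ) {n : ℕ} {y : ℝ} (hy : y ≤ (T α (n + 2)).im) :
    sinePiece α n y = Real.sin (nrm α (n + 2)) := by
  rw [sinePiece, max_eq_left, add_zero]
  exact div_nonpos_of_nonpos_of_nonneg (by linarith) (arcR_pos hα _).le

lemma sinePiece_of_ge (hα : Admissible α κ) {n : ℕ} {y : ℝ} (hy : (T α (n + 2)).im ≤ y) :
    sinePiece α n y = (y - (arcC α (n + 1)).im) / arcR α (n + 1) := by
  have hr := arcR_pos hα (n + 1)
  rw [sinePiece, max_eq_right (div_nonneg (by linarith) hr.le), T_im_eq_arcC]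
  field_simp
  ring

lemma sinePiece_right (hα : Admissible α κ) (n : ℕ) :
    sinePiece α n (S α (n + 2)).im = Real.sin (nrm α (n + 1)) := by
  have hr := arcR_pos hα (n + 1)
  rw [sinePiece_of_ge hα (T_im_lt_S_im hα n).le, S_im_eq_arcC hα]
  field_simp
  ring

lemma slopesIn_sinePiece (hα : Admissible α κ) (n : ℕ) (a c : ℝ) :
    SlopesIn (sinePiece α n) (1 / arcR α (n + 1)) a c := by
  have hr := arcR_pos hα (n + 1)
  intro y _ y' _ hyy
  have h1 : (y - (T α (n + 2)).im) / arcR α (n + 1) ≤ (y' - (T α (n + 2)).im) / arcR α (n + 1) := by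
    gcongr
  have h2 : 1 / arcR α (n + 1) * (y' - y) =
      (y' - (T α (n + 2)).im) / arcR α (n + 1) - (y - (T α (n + 2)).im) / arcR α (n + 1) := by ring
  simp only [sinePiece, h2]
  constructor
  · linarith [max_le_max_left 0 h1]
  · rcases max_cases 0 ((y' - (T α (n + 2)).im) / arcR α (n + 1)) with h | h <;>
      rcases max_cases 0 ((y - (T α (n + 2)).im) / arcR α (n + 1)) with h' | h' <;> linarith

lemma IsSupportedAt.exists_mk_re {Ω : Set ℂ} {p : ℂ} {φ y : ℝ} (h : IsSupportedAt Ω p φ)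
    (hy : p.im = y) : ∃ x : ℝ, IsSupportedAt Ω ⟨x, y⟩ φ :=
  ⟨p.re, by subst hy; exact h⟩

/-- The boundary point at a given height and the normal there. -/
lemma exists_isSupportedAt (hα : Admissible α κ) {n : ℕ} {y : ℝ}
    (hy : y ∈ Icc (S α (n + 3)).im (S α (n + 2)).im) :
    ∃ x : ℝ, IsSupportedAt (K α) ⟨x, y⟩ (Real.arcsin (sinePiece α n y)) := by
  have hpi := Real.pi_pos
  rcases le_total y (T α (n + 2)).im with h | h
  · rw [sinePiece_of_le hα h, Real.arcsin_sin (by linarith [hα.nrm_pos (n + 2)])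
      (hα.nrm_succ_lt (n + 1)).le]
    have hc := cos_nrm_succ_pos hα (n + 1)
    have hs := isSupportedAt_segment hα (n := n + 1)
      (s := ((T α (n + 2)).im - y) / Real.cos (nrm α (n + 2)))
      (div_nonneg (by linarith) hc.le) (by
        rw [div_le_iff₀ hc]
        have h1 := hy.1
        rw [S_succ_eq_T_sub hα (n + 2)] at h1
        simp only [Complex.sub_im, Complex.smul_im, smul_eq_mul] at h1
        linarith)
    refine hs.exists_mk_re ?_
    simp only [Complex.sub_im, Complex.smul_im, smul_eq_mul]
    field_simp
    ring
  · have hr := arcR_pos hα (n + 1)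
    have hlow : Real.sin (nrm α (n + 2)) ≤ sinePiece α n y := by
      rw [sinePiece]; linarith [le_max_left 0 ((y - (T α (n + 2)).im) / arcR α (n + 1))]
    have hup : sinePiece α n y ≤ Real.sin (nrm α (n + 1)) := by
      rw [← sinePiece_right hα]
      linarith [(slopesIn_sinePiece hα n y (S α (n + 2)).im y ⟨le_rfl, hy.2⟩ _ ⟨hy.2, le_rfl⟩
        hy.2).1]
    have h1 := Real.arcsin_le_arcsin hlow
    have h2 := Real.arcsin_le_arcsin hup
    rw [Real.arcsin_sin (by linarith [hα.nrm_pos (n + 2)]) (hα.nrm_succ_lt (n + 1)).le] at h1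
    rw [Real.arcsin_sin (by linarith [hα.nrm_pos (n + 1)]) (hα.nrm_succ_lt n).le] at h2
    have hs := isSupportedAt_arc hα (n := n + 1) ⟨h1, h2⟩ (Real.arcsin_le_pi_div_two _)
    refine hs.exists_mk_re ?_
    simp only [Complex.add_im, Complex.smul_im, smul_eq_mul, dir_im]
    rw [Real.sin_arcsin (by linarith [sin_nrm_succ_pos hα (n + 1)])
      (hup.trans (Real.sin_le_one _)), sinePiece_of_ge hα h]
    field_simp
    ring

/-- The normal angle of the boundary near `1` as a function of the ordinate. -/
lemma exists_normalAngle (hα : Admissible α κ) :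
    ∃ b > 0, ∃ ψ : ℝ → ℝ, ContinuousOn ψ (Icc (-b) b) ∧
      (∀ y ∈ Icc (-b) b, |ψ y| < Real.pi / 2) ∧
      (∀ y ∈ Icc (-b) b, ∃ x : ℝ, IsSupportedAt (K α) ⟨x, y⟩ (ψ y)) ∧
      ((∃ M, ∀ n, 1 / arcR α (n + 1) ≤ M) → ∃ s ∈ 𝓝 (0 : ℝ), ∃ L, LipschitzOnWith L ψ s) := by
  -- The heights start at `S 2`, since the normal angle `nrm α 0` at `S 1` is at least π/2.
  set b : ℕ → ℝ := fun n => (S α (n + 2)).im with hbdef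
  have hbanti : StrictAnti b := strictAnti_nat_of_succ_lt fun n =>
    (S_im_le_T_im hα (n + 1)).trans_lt (T_im_lt_S_im hα n)
  have hb0 : Tendsto b atTop (𝓝 0) :=
    ((Complex.continuous_im.tendsto 1).comp (tendsto_S hα)).comp (tendsto_add_atTop_nat 1)
  have hpos : ∀ n, 0 < b n := fun n =>
    (hbanti.antitone.le_of_tendsto hb0 (n + 1)).trans_lt (hbanti (Nat.lt_succ_self n))
  have hsin0 : Tendsto (fun n => Real.sin (nrm α (n + 1))) atTop (𝓝 0) := by
    have h := (Real.continuous_sin.tendsto 0).comp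
      ((tendsto_nrm hα).comp (tendsto_add_atTop_nat 1))
    rw [Real.sin_zero] at h
    exact h
  obtain ⟨f, hf0, hfq, hfc, hfM⟩ := exists_glue (q := sinePiece α)
    (L := fun n => 1 / arcR α (n + 1)) hbanti hb0
    (fun n => by
      rw [sinePiece_of_le hα (S_im_le_T_im hα (n + 1)), hbdef]
      exact (sinePiece_right hα (n + 1)).symm)
    (fun n => slopesIn_sinePiece hα n _ _)
    (by simpa only [hbdef, sinePiece_right hα] using hsin0)
  have hpiece : ∀ y ∈ Ioc 0 (b 0), ∃ n, y ∈ Icc (b (n + 1)) (b n) := by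
    intro y hy
    have hex : ∃ n, b (n + 1) ≤ y := by
      obtain ⟨n, hn⟩ := (hb0.eventually (gt_mem_nhds hy.1)).exists
      exact ⟨n, (hbanti.antitone (Nat.le_succ n)).trans hn.le⟩
    classical
    refine ⟨Nat.find hex, Nat.find_spec hex, ?_⟩
    rcases Nat.eq_zero_or_pos (Nat.find hex) with h | h
    · rw [h]; exact hy.2
    · have := Nat.find_min hex (Nat.sub_lt h one_pos)
      rw [show Nat.find hex - 1 + 1 = Nat.find hex from Nat.sub_add_cancel h] at this
      exact (not_le.1 this).le
  have hf1 : ∀ y ∈ Icc 0 (b 0), 0 ≤ f y ∧ f y < 1 := by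
    intro y hy
    rcases hy.1.eq_or_lt with rfl | h
    · rw [hf0]; norm_num
    · obtain ⟨n, hn⟩ := hpiece y ⟨h, hy.2⟩
      rw [hfq n y hn]
      constructor
      · exact add_nonneg (sin_nrm_succ_pos hα (n + 1)).le (le_max_left _ _)
      · have h1 := (slopesIn_sinePiece hα n y (b n) y ⟨le_rfl, hn.2⟩ _ ⟨hn.2, le_rfl⟩ hn.2).1
        rw [hbdef, sinePiece_right hα] at h1
        have h2 : Real.sin (nrm α (n + 1)) < Real.sin (Real.pi / 2) :=
          Real.sin_lt_sin_of_lt_of_le_pi_div_two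
            (by linarith [hα.nrm_pos (n + 1), Real.pi_pos]) le_rfl (hα.nrm_succ_lt n)
        rw [Real.sin_pi_div_two] at h2
        linarith
  have hfs : ∀ y ∈ Icc 0 (b 0), ∃ x : ℝ, IsSupportedAt (K α) ⟨x, y⟩ (Real.arcsin (f y)) := by
    intro y hy
    rcases hy.1.eq_or_lt with rfl | h
    · rw [hf0, Real.arcsin_zero]
      exact ⟨1, isSupportedAt_one hα⟩
    · obtain ⟨n, hn⟩ := hpiece y ⟨h, hy.2⟩
      rw [hfq n y hn]
      exact exists_isSupportedAt hα hn
  -- Reflection in the real axis negates the normal angle, so the sine is extended as an odd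
  -- function.
  set F : ℝ → ℝ := fun y => f (max y 0) - f (max (-y) 0) with hFdef
  have hFpos : ∀ y, 0 ≤ y → F y = f y := fun y hy => by
    simp only [hFdef]; rw [max_eq_left hy, max_eq_right (by linarith), hf0, sub_zero]
  have hFneg : ∀ y, y ≤ 0 → F y = -f (-y) := fun y hy => by
    simp only [hFdef]; rw [max_eq_right hy, max_eq_left (by linarith), hf0, zero_sub]
  have hmaps1 : MapsTo (fun y : ℝ => max y 0) (Icc (-b 0) (b 0)) (Icc 0 (b 0)) :=
    fun y hy => ⟨le_max_right _ _, max_le hy.2 (hpos 0).le⟩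
  have hmaps2 : MapsTo (fun y : ℝ => max (-y) 0) (Icc (-b 0) (b 0)) (Icc 0 (b 0)) :=
    fun y hy => ⟨le_max_right _ _, max_le (by linarith [hy.1]) (hpos 0).le⟩
  have hFc : ContinuousOn F (Icc (-b 0) (b 0)) :=
    (hfc.comp (by fun_prop) hmaps1).sub (hfc.comp (by fun_prop) hmaps2)
  refine ⟨b 0, hpos 0, fun y => Real.arcsin (F y),
    Real.continuous_arcsin.comp_continuousOn hFc, ?_, ?_, ?_⟩
  · intro y hy
    rw [abs_lt, Real.neg_pi_div_two_lt_arcsin, Real.arcsin_lt_pi_div_two]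
    rcases le_total 0 y with h | h
    · rw [hFpos y h]
      have := hf1 y ⟨h, hy.2⟩
      constructor <;> linarith
    · rw [hFneg y h]
      have := hf1 (-y) ⟨by linarith, by linarith [hy.1]⟩
      constructor <;> linarith
  · intro y hy
    simp only
    rcases le_total 0 y with h | h
    · rw [hFpos y h]; exact hfs y ⟨h, hy.2⟩
    · rw [hFneg y h, Real.arcsin_neg]
      obtain ⟨x, hx⟩ := hfs (-y) ⟨by linarith, by linarith [hy.1]⟩
      refine ⟨x, ?_⟩
      have := hx.conj (fun z hz => conj_mem_K hα hz)
      convert this using 1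
      apply Complex.ext <;> simp
  · rintro ⟨M, hM⟩
    have hM0 : 0 ≤ M := (div_nonneg zero_le_one (arcR_pos hα 1).le).trans (hM 0)
    have hlip : LipschitzOnWith M.toNNReal f (Icc 0 (b 0)) := by
      refine LipschitzOnWith.of_dist_le_mul fun u hu v hv => ?_
      rw [Real.coe_toNNReal _ hM0, Real.dist_eq, Real.dist_eq]
      rcases le_total u v with huv | huv
      · have := hfM M hM u hu v hv huv
        rw [abs_sub_comm, abs_of_nonneg this.1, abs_sub_comm, abs_of_nonneg (by linarith)]
        exact this.2
      · have := hfM M hM v hv u hu huv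
        rw [abs_of_nonneg this.1, abs_of_nonneg (by linarith)]
        exact this.2
    have hl1 : LipschitzWith 1 fun y : ℝ => max y 0 := LipschitzWith.id.max_const 0
    have hl2 : LipschitzWith 1 fun y : ℝ => max (-y) 0 := LipschitzWith.id.neg.max_const 0
    have hFlip := (hlip.comp hl1.lipschitzOnWith hmaps1).sub (hlip.comp hl2.lipschitzOnWith hmaps2)
    -- The arcsine is not Lipschitz up to ±1, so the neighbourhood is shrunk to where `F` is near `F
    -- 0 = 0`.
    obtain ⟨N, t, ht, hN⟩ := (Real.contDiffAt_arcsin (x := F 0) (n := 1)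
      (by rw [hFpos 0 le_rfl, hf0]; norm_num)
      (by rw [hFpos 0 le_rfl, hf0]; norm_num)).exists_lipschitzOnWith
    have hnhds : Icc (-b 0) (b 0) ∈ 𝓝 (0 : ℝ) := Icc_mem_nhds (by linarith [hpos 0]) (hpos 0)
    refine ⟨Icc (-b 0) (b 0) ∩ F ⁻¹' t, inter_mem hnhds (hFc.continuousAt hnhds ht), _,
      hN.comp (hFlip.mono inter_subset_left) fun y hy => hy.2⟩

lemma exists_boundaryGraph_K (hα : Admissible α κ) :
    ∃ g : ℝ → ℝ, IsBoundaryGraph (K α) 1 g ∧ ContDiffAt ℝ 1 g (1 : ℂ).im ∧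
      ((∃ M, ∀ n, 1 / arcR α (n + 1) ≤ M) →
        ∃ s ∈ 𝓝 (1 : ℂ).im, ∃ L, LipschitzOnWith L (deriv g) s) := by
  obtain ⟨b, hb, ψ, h1, h2, h3, h4⟩ := exists_normalAngle hα
  obtain ⟨g, hg1, hg2, hg3⟩ := exists_boundaryGraph (isClosed_K hα) (convex_K hα)
    (zero_mem_interior_K hα) (isSupportedAt_one hα).mem_frontier (by simp) (by simp) hb h1 h2 h3
  exact ⟨g, hg1, hg2, fun h => hg3 (h4 h)⟩

lemma boundaryC1Around_K (hα : Admissible α κ) : BoundaryC1Around (K α) 1 := by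
  obtain ⟨g, hg1, hg2, -⟩ := exists_boundaryGraph_K hα
  exact ⟨g, hg1, hg2⟩

/-- The curvature is tan `turn α n` / sin `hgap α (n + 1)`, and `turn α n` is the mean of two
consecutive half-gaps. The constants come from sin x ≥ 2x/π and from cos ≥ 1/2 for the turning
angle. -/
lemma one_div_arcR_le (hα : Admissible α κ) {M : ℝ} {n : ℕ}
    (h : hgap α n ≤ M * hgap α (n + 1)) : 1 / arcR α n ≤ Real.pi * (M + 1) / 2 := by
  have hpi := Real.pi_pos
  have hδ := hα.hgap_pos (n + 1)
  have hs : 2 / Real.pi * hgap α (n + 1) ≤ Real.sin (hgap α (n + 1)) :=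
    Real.mul_le_sin hδ.le (by linarith [hα.hgap_lt (n + 1)])
  have ht := turn_pos hα n
  have hc : 1 / 2 ≤ Real.cos (turn α n) := by
    have h1 := Real.one_sub_mul_le_cos ht.le (by linarith [turn_lt hα n])
    have h2 : 2 / Real.pi * turn α n ≤ 2 / Real.pi * (Real.pi / 4) := by
      gcongr; exact (turn_lt hα n).le
    have h3 : 2 / Real.pi * (Real.pi / 4) = 1 / 2 := by field_simp; norm_num
    linarith
  have hsin : Real.sin (turn α n) ≤ turn α n := Real.sin_le ht.le
  have hturn : turn α n ≤ (M + 1) / 2 * hgap α (n + 1) := by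
    simp only [turn, nrm_sub]; linarith
  have hpos : 0 < Real.sin (hgap α (n + 1)) * Real.cos (turn α n) :=
    mul_pos (hα.sin_hgap_pos _) (cos_turn_pos hα n)
  rw [arcR, one_div_div, div_le_iff₀ hpos]
  have hM : 0 ≤ (M + 1) / 2 := by
    by_contra hneg
    push Not at hneg
    nlinarith
  calc Real.sin (turn α n) ≤ (M + 1) / 2 * hgap α (n + 1) := hsin.trans hturn
    _ = Real.pi * (M + 1) / 2 * (2 / Real.pi * hgap α (n + 1) * (1 / 2)) := by field_simp
    _ ≤ Real.pi * (M + 1) / 2 * (Real.sin (hgap α (n + 1)) * Real.cos (turn α n)) := by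
        have : 0 ≤ Real.pi * (M + 1) / 2 := by
          rw [mul_div_assoc]; positivity
        gcongr
        exact (hα.sin_hgap_pos _).le

lemma boundaryC11Around_K (hα : Admissible α κ) {M : ℝ}
    (h : ∀ n ≥ 1, hgap α n ≤ M * hgap α (n + 1)) : BoundaryC11Around (K α) 1 := by
  obtain ⟨g, hg1, hg2, hg3⟩ := exists_boundaryGraph_K hα
  exact ⟨g, hg1, hg2, hg3 ⟨_, fun n => one_div_arcR_le hα (h (n + 1) (by omega))⟩⟩

/-! ### The metric projection and its difference quotients at 2. -/

lemma mem_metricProjection_iff {Ω : Set ℂ} (hΩ : Convex ℝ Ω) {x p : ℂ} :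
    p ∈ metricProjection Ω x ↔ p ∈ Ω ∧ ∀ w ∈ Ω, inner ℝ (x - p) (w - p) ≤ 0 := by
  refine and_congr_right fun hp => ?_
  rw [← norm_eq_iInf_iff_real_inner_le_zero hΩ hp, Metric.infDist_eq_iInf, eq_comm]
  simp only [dist_eq_norm]

lemma metricProjection_subsingleton {Ω : Set ℂ} (hΩ : Convex ℝ Ω) {x p q : ℂ}
    (hp : p ∈ metricProjection Ω x) (hq : q ∈ metricProjection Ω x) : p = q := by
  rw [mem_metricProjection_iff hΩ] at hp hq
  have h1 := hp.2 q hq.1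
  have h2 := hq.2 p hp.1
  rw [← sub_eq_zero, ← inner_self_eq_zero (𝕜 := ℝ)]
  have h3 : inner ℝ (p - q) (p - q) = inner ℝ (x - p) (q - p) + inner ℝ (x - q) (p - q) := by
    simp only [inner_eq_re_im, Complex.sub_re, Complex.sub_im]; ring
  exact le_antisymm (by linarith) real_inner_self_nonneg

lemma exists_metricProjection_eq {Ω : Set ℂ} (hne : Ω.Nonempty) (hcl : IsClosed Ω)
    (hΩ : Convex ℝ Ω) : ∃ P : ℂ → ℂ, ∀ y, metricProjection Ω y = {P y} := by
  have h : ∀ y, ∃ p, metricProjection Ω y = {p} := by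
    intro y
    obtain ⟨p, hp, hmin⟩ := exists_norm_eq_iInf_of_complete_convex hne hcl.isComplete hΩ y
    have hpm : p ∈ metricProjection Ω y := by
      rw [mem_metricProjection_iff hΩ]
      exact ⟨hp, (norm_eq_iInf_iff_real_inner_le_zero hΩ hp).1 hmin⟩
    exact ⟨p, Set.eq_singleton_iff_unique_mem.2
      ⟨hpm, fun q hq => metricProjection_subsingleton hΩ hq hpm⟩⟩
  choose P hP using h
  exact ⟨P, hP⟩

/-- Points on the normal ray of a boundary point project to this boundary point. -/
lemma IsSupportedAt.mem_metricProjection {Ω : Set ℂ} (hΩ : Convex ℝ Ω) {p : ℂ} {φ s : ℝ}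
    (h : IsSupportedAt Ω p φ) (hs : 0 ≤ s) : p ∈ metricProjection Ω (p + s • dir φ) := by
  rw [mem_metricProjection_iff hΩ]
  refine ⟨h.1, fun w hw => ?_⟩
  have h1 : inner ℝ (p + s • dir φ - p) (w - p) = s * (supp φ w - supp φ p) := by
    simp only [inner_eq_re_im, add_sub_cancel_left, Complex.smul_re, Complex.smul_im, dir_re,
      dir_im, Complex.sub_re, Complex.sub_im, supp, smul_eq_mul]
    ring
  rw [h1]
  exact mul_nonpos_of_nonneg_of_nonpos hs (by linarith [h.2 w hw])

/-- The point of the line `re = 2` on the normal at the point of the side at distance `τ`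
from the midpoint `T`. -/
lemma two_add_eq {φ δ τ : ℝ} (hφ : Real.cos φ ≠ 0) :
    (2 : ℂ) + ((2 * Real.sin φ - τ) / Real.cos φ) • Complex.I =
      (Real.cos δ • dir φ - τ • (⟨-Real.sin φ, Real.cos φ⟩ : ℂ)) +
        (2 * Real.cos φ + (2 * Real.sin φ - τ) / Real.cos φ * Real.sin φ - Real.cos δ) • dir φ := by
  have hsq := Real.sin_sq_add_cos_sq φ
  apply Complex.ext
  · simp only [Complex.add_re, Complex.sub_re, Complex.smul_re, dir_re, smul_eq_mul, Complex.I_re,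
      Complex.re_ofNat]
    field_simp
    linear_combination (-2 * Real.cos φ) * hsq
  · simp only [Complex.add_im, Complex.sub_im, Complex.smul_im, dir_im, smul_eq_mul, Complex.I_im,
      Complex.im_ofNat]
    field_simp
    linear_combination (τ - 2 * Real.sin φ) * hsq

lemma sin_hgap_le_sin_nrm (hα : Admissible α κ) (n : ℕ) :
    Real.sin (hgap α (n + 1)) ≤ Real.sin (nrm α (n + 1)) := by
  have h1 := hα.ang_pos (n + 2)
  refine Real.sin_le_sin_of_le_of_le_pi_div_two (by linarith [hα.hgap_pos (n + 1), Real.pi_pos])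
    (hα.nrm_succ_lt n).le ?_
  simp only [hgap, nrm]; linarith

/-- The flat segment is not negligible against its normal angle. Contraction of the angles gives
`hgap` ≥ (1 − κ)/2 · `nrm`, contraction of the gaps gives a difference of at least (1 − κ) · `hgap`,
and passing to sines costs a factor π. -/
lemma sin_hgap_sub_ge (hα : Admissible α κ) (n : ℕ) :
    (1 - κ) ^ 2 / (2 * Real.pi) * Real.sin (nrm α (n + 1)) ≤
      Real.sin (hgap α (n + 1)) - Real.sin (hgap α (n + 2)) := by
  have hpi := Real.pi_pos
  have hκ := hα.lt_one
  have h1 := hα.hgap_contract n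
  have h2 := hα.hgap_pos (n + 1)
  have h3 := hα.hgap_pos (n + 2)
  have h4 := hα.hgap_lt (n + 1)
  have h5 := hα.hgap_succ_le (n + 1)
  have h6 : hgap α (n + 2) < Real.pi / 4 := hα.hgap_lt (n + 2)
  have hang : nrm α (n + 1) * ((1 - κ) / 2) ≤ hgap α (n + 1) := by
    have e1 : ang α (n + 2) ≤ κ * ang α (n + 1) := hα.contract (n + 1) (by omega)
    have e2 := hα.ang_pos (n + 1)
    have e3 := hα.ang_pos (n + 2)
    have e4 : 0 ≤ (1 - κ) * (ang α (n + 1) - ang α (n + 2)) :=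
      mul_nonneg (by linarith) (by nlinarith)
    simp only [nrm, hgap]
    linarith
  have hsn : Real.sin (nrm α (n + 1)) ≤ nrm α (n + 1) := Real.sin_le (hα.nrm_pos _).le
  rw [Real.sin_sub_sin]
  have hs := Real.mul_le_sin (x := (hgap α (n + 1) - hgap α (n + 2)) / 2)
    (by linarith) (by linarith)
  have hc : 1 / 2 ≤ Real.cos ((hgap α (n + 1) + hgap α (n + 2)) / 2) := by
    have e1 := Real.one_sub_mul_le_cos (x := (hgap α (n + 1) + hgap α (n + 2)) / 2)
      (by linarith) (by linarith)
    have e2 : 2 / Real.pi * ((hgap α (n + 1) + hgap α (n + 2)) / 2) ≤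
        2 / Real.pi * (Real.pi / 4) :=
      mul_le_mul_of_nonneg_left (by linarith) (by positivity)
    have e3 : 2 / Real.pi * (Real.pi / 4) = 1 / 2 := by field_simp; norm_num
    linarith
  have hd : 0 ≤ 2 / Real.pi * ((hgap α (n + 1) - hgap α (n + 2)) / 2) := by
    have : 0 ≤ hgap α (n + 1) - hgap α (n + 2) := by linarith
    positivity
  have hκ' : 0 < 1 - κ := by linarith
  calc (1 - κ) ^ 2 / (2 * Real.pi) * Real.sin (nrm α (n + 1))
      ≤ (1 - κ) ^ 2 / (2 * Real.pi) * nrm α (n + 1) := by gcongr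
    _ = (1 - κ) / Real.pi * (nrm α (n + 1) * ((1 - κ) / 2)) := by field_simp
    _ ≤ (1 - κ) / Real.pi * hgap α (n + 1) := by gcongr
    _ = 1 / Real.pi * ((1 - κ) * hgap α (n + 1)) := by ring
    _ ≤ 1 / Real.pi * (hgap α (n + 1) - hgap α (n + 2)) := by gcongr; linarith
    _ = 2 * (2 / Real.pi * ((hgap α (n + 1) - hgap α (n + 2)) / 2)) * (1 / 2) := by
        field_simp
    _ ≤ 2 * Real.sin ((hgap α (n + 1) - hgap α (n + 2)) / 2) *
        Real.cos ((hgap α (n + 1) + hgap α (n + 2)) / 2) := by gcongr; linarith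

/-- The projections of points on the line `re = 2` onto the points of the sides. -/
lemma projection_eq (hα : Admissible α κ) {P : ℂ → ℂ}
    (hP : ∀ y, metricProjection (K α) y = {P y}) {n : ℕ} {τ : ℝ} (h0 : 0 ≤ τ)
    (hτ : τ ≤ Real.sin (hgap α (n + 1)) - Real.sin (hgap α (n + 2))) :
    (P (2 + ((2 * Real.sin (nrm α (n + 1)) - τ) / Real.cos (nrm α (n + 1))) • Complex.I)).im =
      Real.cos (hgap α (n + 1)) * Real.sin (nrm α (n + 1)) - τ * Real.cos (nrm α (n + 1)) := by
  have hc := cos_nrm_succ_pos hα n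
  have hs := sin_nrm_succ_pos hα n
  have hle := sin_hgap_le_sin_nrm hα n
  have hpos := hα.sin_hgap_pos (n + 2)
  have hsup := isSupportedAt_segment hα h0 hτ
  rw [T_eq_dir] at hsup
  -- The point on re = 2 must lie on the outward normal ray. As `τ` is at most the sine of the
  -- normal angle, this reduces to 1 / cos ≥ 1.
  have hnonneg : 0 ≤ 2 * Real.cos (nrm α (n + 1)) + (2 * Real.sin (nrm α (n + 1)) - τ) /
      Real.cos (nrm α (n + 1)) * Real.sin (nrm α (n + 1)) - Real.cos (hgap α (n + 1)) := by
    have h1 : Real.sin (nrm α (n + 1)) / Real.cos (nrm α (n + 1)) * Real.sin (nrm α (n + 1)) ≤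
        (2 * Real.sin (nrm α (n + 1)) - τ) / Real.cos (nrm α (n + 1)) *
          Real.sin (nrm α (n + 1)) := by
      gcongr; linarith
    have h2 : 1 ≤ Real.cos (nrm α (n + 1)) +
        Real.sin (nrm α (n + 1)) / Real.cos (nrm α (n + 1)) * Real.sin (nrm α (n + 1)) := by
      have e : Real.cos (nrm α (n + 1)) +
          Real.sin (nrm α (n + 1)) / Real.cos (nrm α (n + 1)) * Real.sin (nrm α (n + 1)) =
          1 / Real.cos (nrm α (n + 1)) := by
        field_simp
        linear_combination Real.sin_sq_add_cos_sq (nrm α (n + 1))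
      rw [e, le_div_iff₀ hc, one_mul]
      exact Real.cos_le_one _
    linarith [Real.cos_le_one (hgap α (n + 1))]
  have hmem := hsup.mem_metricProjection (convex_K hα) hnonneg
  rw [← two_add_eq hc.ne', hP, mem_singleton_iff] at hmem
  rw [← hmem]
  simp only [Complex.sub_im, Complex.smul_im, dir_im, smul_eq_mul]

lemma not_hasDirectionalDerivAt (hα : Admissible α κ) {P : ℂ → ℂ}
    (hP : ∀ y, metricProjection (K α) y = {P y}) (d : ℂ) :
    ¬ HasDirectionalDerivAt P 2 Complex.I d := by
  intro hd
  have hP2 : P 2 = 1 := by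
    have h := (isSupportedAt_one hα).mem_metricProjection (convex_K hα) (zero_le_one (α := ℝ))
    have e : (1 : ℂ) + (1 : ℝ) • dir 0 = 2 := by
      apply Complex.ext <;> simp; norm_num
    rw [e, hP, mem_singleton_iff] at h
    exact h.symm
  have him : Tendsto (fun t : ℝ => t⁻¹ * (P (2 + t • Complex.I)).im) (𝓝[>] 0) (𝓝 d.im) := by
    have h := (Complex.continuous_im.tendsto d).comp hd
    refine h.congr fun t => ?_
    simp [hP2]
  have hnrm := (tendsto_nrm hα).comp (tendsto_add_atTop_nat 1)
  have hcosn : Tendsto (fun n => Real.cos (nrm α (n + 1))) atTop (𝓝 1) := by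
    have h := (Real.continuous_cos.tendsto 0).comp hnrm
    rw [Real.cos_zero] at h; exact h
  have hsinn : Tendsto (fun n => Real.sin (nrm α (n + 1))) atTop (𝓝 0) := by
    have h := (Real.continuous_sin.tendsto 0).comp hnrm
    rw [Real.sin_zero] at h; exact h
  have hcosδ : Tendsto (fun n => Real.cos (hgap α (n + 1))) atTop (𝓝 1) := by
    have h := (Real.continuous_cos.tendsto 0).comp
      ((tendsto_hgap hα).comp (tendsto_add_atTop_nat 1))
    rw [Real.cos_zero] at h; exact h
  have hsin := sin_nrm_succ_pos hα
  have hcos := cos_nrm_succ_pos hα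
  -- along each sequence of points on the sides the difference quotients converge
  have hlim : ∀ τ : ℕ → ℝ, (∀ n, 0 ≤ τ n) →
      (∀ n, τ n ≤ Real.sin (hgap α (n + 1)) - Real.sin (hgap α (n + 2))) →
      Tendsto (fun n => (Real.cos (hgap α (n + 1)) * Real.sin (nrm α (n + 1)) -
        τ n * Real.cos (nrm α (n + 1))) * Real.cos (nrm α (n + 1)) /
          (2 * Real.sin (nrm α (n + 1)) - τ n)) atTop (𝓝 d.im) := by
    intro τ h0 hτ
    have hpos : ∀ n, 0 < 2 * Real.sin (nrm α (n + 1)) - τ n := fun n => by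
      linarith [hτ n, sin_hgap_le_sin_nrm hα n, hα.sin_hgap_pos (n + 2), hsin n]
    have ht : Tendsto (fun n => (2 * Real.sin (nrm α (n + 1)) - τ n) / Real.cos (nrm α (n + 1)))
        atTop (𝓝[>] 0) := by
      refine tendsto_nhdsWithin_iff.2 ⟨?_, Eventually.of_forall fun n => div_pos (hpos n) (hcos n)⟩
      have hup := (hsinn.const_mul 2).div hcosn one_ne_zero
      rw [mul_zero, zero_div] at hup
      refine squeeze_zero (fun n => (div_pos (hpos n) (hcos n)).le) (fun n => ?_) hup
      have := hcos n
      simp only [Pi.div_apply]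
      gcongr
      linarith [h0 n]
    refine (him.comp ht).congr fun n => ?_
    have h1 := (hpos n).ne'
    have h2 := (hcos n).ne'
    simp only [Function.comp_apply]
    rw [projection_eq hα hP (h0 n) (hτ n), inv_div]
    ring
  -- Test at the foot points, `τ = 0`.
  have hhalf : d.im = 1 / 2 := by
    have h1 := hlim (fun _ => 0) (fun _ => le_rfl)
      fun n => sub_nonneg.2 (hα.sin_hgap_succ_le (n + 1))
    have h2 : Tendsto (fun n => Real.cos (hgap α (n + 1)) * Real.cos (nrm α (n + 1)) / 2) atTop
        (𝓝 (1 * 1 / 2)) := (hcosδ.mul hcosn).div_const 2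
    rw [mul_one] at h2
    refine tendsto_nhds_unique h1 (h2.congr fun n => ?_)
    have := (hsin n).ne'
    field_simp
    ring
  set ρ := (1 - κ) ^ 2 / (2 * Real.pi) with hρ
  have hρ0 : 0 < ρ := by
    have h1 := hα.lt_one
    have h2 : 0 < 1 - κ := by linarith
    have h3 := Real.pi_pos
    positivity
  -- Test at the other ends `S (n + 2)`. With s the sine of the normal angle, the quotient is close
  -- to (s − τ)/(2s − τ), below 1/2 by at least τ/(4s) ≥ ρ/4. The tolerances ρ/16 and 3/4 that
  -- follow leave τ/4 against ρs/8, still a contradiction.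
  have h1 := hlim (fun n => Real.sin (hgap α (n + 1)) - Real.sin (hgap α (n + 2)))
    (fun n => sub_nonneg.2 (hα.sin_hgap_succ_le (n + 1))) fun n => le_rfl
  have h2 := h1.eventually (lt_mem_nhds (show 1 / 2 - ρ / 16 < d.im by rw [hhalf]; linarith))
  have h3 := (hcosn.pow 2).eventually (lt_mem_nhds (show (3 / 4 : ℝ) < 1 ^ 2 by norm_num))
  obtain ⟨n, hn2, hn3⟩ := (h2.and h3).exists
  have hs := hsin n
  have hτ := sin_hgap_sub_ge hα n
  have hτ2 := sin_hgap_le_sin_nrm hα n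
  have hτ3 := hα.sin_hgap_pos (n + 2)
  rw [← hρ] at hτ
  set τ := Real.sin (hgap α (n + 1)) - Real.sin (hgap α (n + 2))
  have hτ0 : 0 < τ := lt_of_lt_of_le (by positivity) hτ
  have hτs : τ < Real.sin (nrm α (n + 1)) := by simp only [τ]; linarith
  rw [lt_div_iff₀ (by linarith)] at hn2
  have hcc : Real.cos (hgap α (n + 1)) * Real.cos (nrm α (n + 1)) ≤ 1 :=
    mul_le_one₀ (Real.cos_le_one _) (hcos n).le (Real.cos_le_one _)
  have e1 : Real.sin (nrm α (n + 1)) *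
      (Real.cos (hgap α (n + 1)) * Real.cos (nrm α (n + 1))) ≤ Real.sin (nrm α (n + 1)) :=
    mul_le_of_le_one_right hs.le hcc
  have e2 : τ * (3 / 4) ≤ τ * Real.cos (nrm α (n + 1)) ^ 2 := by gcongr
  have e3 : 0 < ρ * τ := by positivity
  have e4 : 0 < ρ * Real.sin (nrm α (n + 1)) := by positivity
  nlinarith

lemma projectionNotDirDiffAt_K (hα : Admissible α κ) :
    ProjectionNotDirDiffAt (K α) 2 Complex.I := by
  have hne : (K α).Nonempty := ⟨1, (isSupportedAt_one hα).1⟩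
  refine ⟨hne, isClosed_K hα, convex_K hα, fun h => ?_, ?_⟩
  · have := re_le_one_of_mem_K hα h
    norm_num at this
  · obtain ⟨P, hP⟩ := exists_metricProjection_eq hne (isClosed_K hα) (convex_K hα)
    exact ⟨P, hP, fun ⟨d, hd⟩ => not_hasDirectionalDerivAt hα hP d hd⟩

/-! ### Lipschitz slope forces bounded gap ratios. -/

lemma sub_le_tan_sub_tan {a b : ℝ} (hb : 0 ≤ b) (hab : b ≤ a) (ha : a < Real.pi / 2) :
    2 / Real.pi * (a - b) ≤ Real.tan a - Real.tan b := by
  have hca : 0 < Real.cos a := Real.cos_pos_of_mem_Ioo ⟨by linarith, ha⟩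
  have hcb : 0 < Real.cos b := Real.cos_pos_of_mem_Ioo ⟨by linarith, by linarith⟩
  have h1 : 2 / Real.pi * (a - b) ≤ Real.sin (a - b) :=
    Real.mul_le_sin (by linarith) (by linarith)
  have h0 : 0 ≤ Real.sin (a - b) :=
    Real.sin_nonneg_of_nonneg_of_le_pi (by linarith) (by linarith [Real.pi_pos])
  have h2 : Real.tan a - Real.tan b = Real.sin (a - b) / (Real.cos a * Real.cos b) := by
    rw [Real.tan_eq_sin_div_cos, Real.tan_eq_sin_div_cos, Real.sin_sub]
    field_simp
  rw [h2]
  refine h1.trans ?_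
  rw [le_div_iff₀ (by positivity)]
  exact mul_le_of_le_one_right h0 (mul_le_one₀ (Real.cos_le_one _) hcb.le (Real.cos_le_one _))

/-- A boundary graph has the slope prescribed by the outer normals. -/
lemma eventually_deriv_eq {Ω : Set ℂ} (hcl : IsClosed Ω) {p₀ : ℂ} {g : ℝ → ℝ}
    (hg : IsBoundaryGraph Ω p₀ g) (hgd : ContDiffAt ℝ 1 g p₀.im) :
    ∀ᶠ p in 𝓝 p₀, ∀ φ, 0 < Real.cos φ → IsSupportedAt Ω p φ →
      deriv g p.im = -Real.tan φ := by
  have hg0 : p₀.re = g p₀.im := hg.2.self_of_nhds.1 hg.1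
  have hcont : ContinuousAt g p₀.im := hgd.continuousAt
  have hc : ContinuousAt (fun y => Complex.equivRealProdCLM.symm (g y, y)) p₀.im :=
    Complex.equivRealProdCLM.symm.continuous.continuousAt.comp (hcont.prodMk continuousAt_id)
  have hp₀ : Complex.equivRealProdCLM.symm (g p₀.im, p₀.im) = p₀ := by
    apply Complex.ext <;> simp [hg0]
  have hmem : ∀ᶠ y in 𝓝 p₀.im, (⟨g y, y⟩ : ℂ) ∈ Ω := by
    have h := hc.eventually (p := fun z => z ∈ frontier Ω ↔ z.re = g z.im)
      (by simpa only [hp₀] using hg.2)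
    filter_upwards [h] with y hy
    have h2 := hy.2 (by simp)
    have := hcl.frontier_subset h2
    convert this using 1
    apply Complex.ext <;> simp
  have hdiff : ∀ᶠ y in 𝓝 p₀.im, DifferentiableAt ℝ g y :=
    (hgd.eventually (by simp)).mono fun y hy => hy.differentiableAt (by simp)
  have him := Complex.continuous_im.continuousAt (x := p₀)
  filter_upwards [him.eventually hmem.eventually_nhds, him.eventually hdiff, hg.2]
    with p h1 h2 h3 φ hφ hp
  have hpre : p.re = g p.im := h3.1 hp.mem_frontier
  -- The supporting line touches the graph at `p` from outside, so its slope is the derivative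
  -- there. This applies to an arbitrary boundary graph, as refuting `BoundaryC11Around` requires.
  have hmax : IsLocalMax (fun u => g u + Real.tan φ * (u - p.im)) p.im := by
    filter_upwards [h1] with u hu
    have := hp.re_le hφ hu
    simp only at this ⊢
    rw [sub_self, mul_zero, add_zero, ← hpre]
    linarith
  have hder : HasDerivAt (fun u => g u + Real.tan φ * (u - p.im))
      (deriv g p.im + Real.tan φ * 1) p.im :=
    h2.hasDerivAt.add (((hasDerivAt_id p.im).sub_const p.im).const_mul (Real.tan φ))
  have := hmax.hasDerivAt_eq_zero hder
  linarith

/-- If the boundary is `C^{1,1}`, then the ratios of consecutive gaps are bounded. -/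
lemma BoundaryC11Around.exists_hgap_le (hα : Admissible α κ) (h : BoundaryC11Around (K α) 1) :
    ∃ M, ∀ᶠ n in atTop, hgap α n ≤ M * hgap α (n + 1) := by
  obtain ⟨g, hg, hgd, s, hs, L, hL⟩ := h
  refine ⟨Real.pi * L, ?_⟩
  have hev := (eventually_deriv_eq (isClosed_K hα) hg hgd).and
    (Complex.continuous_im.continuousAt.eventually hs)
  have hT := (tendsto_T hα).comp (tendsto_add_atTop_nat 2)
  have hS := (tendsto_S hα).comp (tendsto_add_atTop_nat 1)
  -- Across the arc from `S (n + 2)` to `T (n + 2)` the normal turns by `hgap α (n + 1) + hgap α (n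
  -- + 2)`, while the ordinate changes by at most `2 * hgap α (n + 2)`.
  have key : ∀ᶠ n in atTop, hgap α (n + 1) ≤ Real.pi * L * hgap α (n + 1 + 1) := by
    filter_upwards [hT.eventually hev, hS.eventually hev] with n hTn hSn
    have e1 := hTn.1 _ (cos_nrm_succ_pos hα (n + 1)) (isSupportedAt_T hα (n + 1))
    have e2 := hSn.1 _ (cos_nrm_succ_pos hα n) (isSupportedAt_S hα n)
    have e3 := hL.dist_le_mul _ hTn.2 _ hSn.2
    simp only [Function.comp_apply] at e1 e2 e3
    rw [e1, e2, Real.dist_eq, Real.dist_eq] at e3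
    have hpi := Real.pi_pos
    have e4 := sub_le_tan_sub_tan (hα.nrm_pos (n + 2)).le
      (hα.nrm_anti.antitone (Nat.le_succ (n + 1))) (hα.nrm_succ_lt n)
    have e5 : dist (T α (n + 2)) (S α (n + 2)) ≤ 2 * hgap α (n + 2) := by
      have h1 : dist (T α (n + 2)) (A α (n + 2)) = Real.sin (hgap α (n + 2)) := by
        rw [T, dist_midpoint_left, dist_A_succ hα, Real.norm_ofNat]; ring
      have h2 : dist (A α (n + 2)) (S α (n + 2)) = Real.sin (hgap α (n + 2)) := by
        rw [S_succ_eq_A_add hα (n + 1), A_eq_dir, dist_self_add_right, norm_smul, norm_perp,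
          mul_one, Real.norm_eq_abs, abs_of_pos (hα.sin_hgap_pos _)]
      have h3 := dist_triangle (T α (n + 2)) (A α (n + 2)) (S α (n + 2))
      have h4 := Real.sin_le (hα.hgap_pos (n + 2)).le
      linarith
    have e6 : |(T α (n + 2)).im - (S α (n + 2)).im| ≤ 2 * hgap α (n + 2) := by
      rw [← Complex.sub_im]
      refine (Complex.abs_im_le_norm _).trans ?_
      rwa [← dist_eq_norm]
    have e7 := (le_abs_self _).trans e3
    have e8 : (L : ℝ) * |(T α (n + 2)).im - (S α (n + 2)).im| ≤ L * (2 * hgap α (n + 2)) := by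
      gcongr
    have e9 : 2 / Real.pi * (hgap α (n + 1) + hgap α (n + 2)) ≤ L * (2 * hgap α (n + 2)) := by
      rw [← nrm_sub]
      linarith
    rw [div_mul_eq_mul_div, div_le_iff₀ hpi] at e9
    have := hα.hgap_pos (n + 2)
    change hgap α (n + 1) ≤ Real.pi * L * hgap α (n + 2)
    linarith
  obtain ⟨N, hN⟩ := eventually_atTop.1 key
  filter_upwards [eventually_ge_atTop (N + 1)] with n hn
  obtain ⟨m, rfl⟩ : ∃ k, n = k + 1 := ⟨n - 1, by omega⟩
  exact hN m (by omega)

/-! ### The two families of angles and the theorem. -/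

lemma hgap_of_one_le (α : ℕ → ℝ) {n : ℕ} (hn : 1 ≤ n) : hgap α n = (α n - α (n + 1)) / 2 := by
  obtain ⟨m, rfl⟩ : ∃ k, n = k + 1 := ⟨n - 1, by omega⟩
  rfl

lemma admissible_of_geometric {C lam : ℝ} (hC : 0 < C) (hlam : lam ∈ Ioo (0 : ℝ) 1)
    (h : ∀ n ≥ 1, α n = C * lam ^ n) (h1 : α 1 = Real.pi / 2) : Admissible α lam where
  one := h1
  pos n hn := by
    have := hlam.1
    rw [h n hn]; positivity
  lt_one := hlam.2
  contract n hn := by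
    rw [h n hn, h (n + 1) (by omega)]
    exact le_of_eq (by ring)
  gap n hn := by
    rw [h n hn, h (n + 1) (by omega), h (n + 2) (by omega)]
    exact le_of_eq (by ring)

lemma pow_succ_sq (lam : ℝ) (n : ℕ) : lam ^ ((n + 1) ^ 2) = lam ^ (n ^ 2) * lam ^ (2 * n + 1) := by
  rw [← pow_add]; ring_nf

lemma pow_succ_sq_le {lam : ℝ} (h0 : 0 < lam) (h1 : lam < 1) (n : ℕ) :
    lam ^ ((n + 1) ^ 2) ≤ lam ^ (n ^ 2) * lam := by
  rw [pow_succ_sq]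
  gcongr
  exact pow_le_of_le_one h0.le h1.le (by omega)

/-- If consecutive angles have ratio at most λ, consecutive gaps have ratio at most λ/(1 − λ), which
is less than 1 precisely because λ < 1/2. -/
lemma admissible_of_pow_sq {C lam : ℝ} (hC : 0 < C) (hlam : lam ∈ Ioo (0 : ℝ) (1 / 2))
    (h : ∀ n ≥ 1, α n = C * lam ^ (n ^ 2)) (h1 : α 1 = Real.pi / 2) :
    Admissible α (lam / (1 - lam)) := by
  have h0 := hlam.1
  have h2 := hlam.2
  have hpos : 0 < 1 - lam := by linarith
  have hle : lam ≤ lam / (1 - lam) := by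
    rw [le_div_iff₀ hpos]; nlinarith
  refine ⟨h1, fun n hn => ?_, ?_, fun n hn => ?_, fun n hn => ?_⟩
  · rw [h n hn]; positivity
  · rw [div_lt_one hpos]; linarith
  · rw [h n hn, h (n + 1) (by omega)]
    have := pow_succ_sq_le h0 (by linarith) n
    calc C * lam ^ ((n + 1) ^ 2) ≤ C * (lam ^ (n ^ 2) * lam) := by gcongr
      _ = lam * (C * lam ^ (n ^ 2)) := by ring
      _ ≤ lam / (1 - lam) * (C * lam ^ (n ^ 2)) := by gcongr
  · rw [h n hn, h (n + 1) (by omega), h (n + 2) (by omega)]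
    have e1 := pow_succ_sq_le h0 (by linarith) n
    have e2 : 0 < lam ^ ((n + 2) ^ 2) := by positivity
    calc C * lam ^ ((n + 1) ^ 2) - C * lam ^ ((n + 2) ^ 2) ≤ C * (lam ^ (n ^ 2) * lam) := by
          nlinarith
      _ = lam / (1 - lam) * (C * lam ^ (n ^ 2) - C * (lam ^ (n ^ 2) * lam)) := by
          field_simp
      _ ≤ lam / (1 - lam) * (C * lam ^ (n ^ 2) - C * lam ^ ((n + 1) ^ 2)) := by gcongr

lemma not_boundaryC11Around_of_pow_sq {C lam : ℝ} (hC : 0 < C)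
    (hlam : lam ∈ Ioo (0 : ℝ) (1 / 2)) (h : ∀ n ≥ 1, α n = C * lam ^ (n ^ 2))
    (h1 : α 1 = Real.pi / 2) : ¬ BoundaryC11Around (K α) 1 := by
  intro hb
  have h0 := hlam.1
  have h2 := hlam.2
  obtain ⟨M, hM⟩ := hb.exists_hgap_le (admissible_of_pow_sq hC hlam h h1)
  have ht : Tendsto (fun n : ℕ => |M| * lam ^ (2 * n + 1)) atTop (𝓝 (|M| * 0)) := by
    refine Tendsto.const_mul _ ((tendsto_pow_atTop_nhds_zero_of_lt_one h0.le (by linarith)).comp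
      (tendsto_atTop_mono (fun n => ?_) tendsto_id))
    simp only [id]; omega
  rw [mul_zero] at ht
  obtain ⟨n, hn, hn1, hn2⟩ := (hM.and ((eventually_ge_atTop 1).and
    (ht.eventually (gt_mem_nhds (show (0 : ℝ) < 1 / 2 by norm_num))))).exists
  rw [hgap_of_one_le α hn1, hgap_of_one_le α (by omega), h n hn1, h (n + 1) (by omega),
    h (n + 1 + 1) (by omega)] at hn
  have e1 := pow_succ_sq_le h0 (by linarith) n
  have e2 : 0 < lam ^ (n ^ 2) := by positivity
  have e3 : 0 < lam ^ ((n + 1 + 1) ^ 2) := by positivity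
  have e4 := pow_succ_sq_le h0 (by linarith) (n + 1)
  have e5 : lam ^ ((n + 1) ^ 2) = lam ^ (n ^ 2) * lam ^ (2 * n + 1) := pow_succ_sq lam n
  have e6 : 0 < lam ^ ((n + 1) ^ 2) := by positivity
  have hdiff : 0 ≤ (C * lam ^ ((n + 1) ^ 2) - C * lam ^ ((n + 1 + 1) ^ 2)) / 2 := by
    rw [← mul_sub]
    have : 0 ≤ lam ^ ((n + 1) ^ 2) - lam ^ ((n + 1 + 1) ^ 2) := by nlinarith
    positivity
  -- The gap at `n` is at least a fraction 1 − λ > 1/2 of `α n`, whereas the bound leaves at most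
  -- |M| λ^(2n+1) < 1/2 of it.
  have hcontra : C * lam ^ (n ^ 2) * (1 - lam) ≤
      C * lam ^ (n ^ 2) * (|M| * lam ^ (2 * n + 1)) := by
    calc C * lam ^ (n ^ 2) * (1 - lam) = C * lam ^ (n ^ 2) - C * (lam ^ (n ^ 2) * lam) := by ring
      _ ≤ C * lam ^ (n ^ 2) - C * lam ^ ((n + 1) ^ 2) := by gcongr
      _ ≤ |M| * (C * lam ^ ((n + 1) ^ 2) - C * lam ^ ((n + 1 + 1) ^ 2)) := by
          have := mul_le_mul_of_nonneg_right (le_abs_self M) hdiff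
          linarith
      _ ≤ |M| * (C * lam ^ ((n + 1) ^ 2)) := by
          gcongr
          linarith [mul_pos hC e3]
      _ = C * lam ^ (n ^ 2) * (|M| * lam ^ (2 * n + 1)) := by rw [e5]; ring
  have := le_of_mul_le_mul_left hcontra (by positivity)
  linarith

end RoundedShapiro

theorem theorem2p6 :
    -- Case B
    (∀ (C lam : ℝ) (α : ℕ → ℝ), 0 < C → lam ∈ Set.Ioo (0 : ℝ) 1 →
      (∀ n ≥ 1, α n = C * lam ^ n) → α 1 = Real.pi / 2 →
        RoundedShapiro.BoundaryC11Around (RoundedShapiro.K α) 1 ∧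
        RoundedShapiro.ProjectionNotDirDiffAt (RoundedShapiro.K α) 2 Complex.I) ∧
    -- Case C
    (∀ (C lam : ℝ) (α : ℕ → ℝ), 0 < C → lam ∈ Set.Ioo (0 : ℝ) (1 / 2) →
      (∀ n ≥ 1, α n = C * lam ^ (n ^ 2)) → α 1 = Real.pi / 2 →
        RoundedShapiro.BoundaryC1Around (RoundedShapiro.K α) 1 ∧
        ¬ RoundedShapiro.BoundaryC11Around (RoundedShapiro.K α) 1 ∧
        RoundedShapiro.ProjectionNotDirDiffAt (RoundedShapiro.K α) 2 Complex.I) := by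
  refine ⟨fun C lam α hC hlam h h1 => ?_, fun C lam α hC hlam h h1 => ?_⟩
  · have hα := RoundedShapiro.admissible_of_geometric hC hlam h h1
    -- The gaps form a geometric sequence of ratio `lam`, so the bound holds with equality.
    refine ⟨RoundedShapiro.boundaryC11Around_K hα (M := lam⁻¹) fun n hn => ?_,
      RoundedShapiro.projectionNotDirDiffAt_K hα⟩
    have h0 := hlam.1.ne'
    rw [RoundedShapiro.hgap_of_one_le α hn, RoundedShapiro.hgap_of_one_le α (by omega), h n hn,
      h (n + 1) (by omega), h (n + 1 + 1) (by omega)]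
    refine le_of_eq ?_
    field_simp
    ring
  · have hα := RoundedShapiro.admissible_of_pow_sq hC hlam h h1
    exact ⟨RoundedShapiro.boundaryC1Around_K hα,
      RoundedShapiro.not_boundaryC11Around_of_pow_sq hC hlam h h1,
      RoundedShapiro.projectionNotDirDiffAt_K hα⟩
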